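/- Let $K\ge 1$ and $L\ge 2$ be fixed integers and let $(\mathbf X_i)_{i\ge 1}$, $\mathbf X_i=(X_{i,1},\dots,X_{i,K})'$, be i.i.d. $\mathbb R^K$-valued random vectors such that, for every $k\in\{1,\dots,K\}$, the cumulative distribution function $F_k$ of $X_{1,k}$ is continuous. Assume that the $K\times K$ matrix $\Sigma$ with entries $\Sigma_{kk'}=4\operatorname{Cov}\bigl(F_k(X_{1,k}),F_{k'}(X_{1,k'})\bigr)$ is positive definite. For each $n$, let the sample $\mathbf X_1,\dots,\mathbf X_n$ be divided into $L$ groups, the $\ell$-th of which ($\ell=0,\dots,L-1$) is $\mathbf X_{n_\ell+1},\dots,\mathbf X_{n_{\ell+1}}$, where $0=n_0\le n_1\le\dots\le n_L=n$ depend on $n$, and assume that for each $\ell=0,\dots,L-1$ there is $t_{\ell+1}\in(0,1)$ such that $(n_{\ell+1}-n_\ell)/n\to t_{\ell+1}$ as $n\to\infty$. Let $$R_j^{(k)}=\sum_{i=1}^n\mathbf 1(X_{i,k}\le X_{j,k}),\qquad \bar R_\ell^{(k)}=\frac1{n_{\ell+1}-n_\ell}\sum_{j=n_\ell+1}^{n_{\ell+1}}R_j^{(k)},$$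 $$\bar{\mathbf R}_\ell=\Bigl(\bar R_\ell^{(1)}-\tfrac{n+1}2,\dots,\bar R_\ell^{(K)}-\tfrac{n+1}2\Bigr)',$$ let $\hat F_{n,k}(s)=n^{-1}\sum_{j=1}^n\mathbf 1(X_{j,k}\le s)$, and let $\hat\Sigma_n$ be the $K\times K$ matrix with entries $$\hat\Sigma_{n,kk'}=\frac4n\sum_{i=1}^n\bigl\{\hat F_{n,k}(X_{i,k})-\tfrac12\bigr\}\bigl\{\hat F_{n,k'}(X_{i,k'})-\tfrac12\bigr\}.$$ Then the multivariate Kruskal–Wallis statistic $$T(n_1,\dots,n_{L-1})=\frac4{n^2}\sum_{\ell=0}^{L-1}(n_{\ell+1}-n_\ell)\,\bar{\mathbf R}_\ell'\,\hat\Sigma_n^{-1}\,\bar{\mathbf R}_\ell$$ converges in distribution, as $n\to\infty$, to the chi-square distribution with $(L-1)K$ degrees of freedom. (On the event that $\hat\Sigma_n$ is singular, whose probability tends to $0$, or that a group is empty, which happens for finitely many $n$ only, $T$ may be given any fixed convention; here the inverse is then read as $0$.) -/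

import Mathlib

open MeasureTheory ProbabilityTheory Filter Topology

namespace KruskalWallis

/-- The chi-square distribution with `d` degrees of freedom: the law of `Z₁² + ⋯ + Z_d²`, where
`Z₁, …, Z_d` are independent standard Gaussian variables. -/
noncomputable def chiSquare (d : ℕ) : Measure ℝ :=
  (Measure.pi fun _ : Fin d => gaussianReal 0 1).map fun z => ∑ i, z i ^ 2

instance (d : ℕ) : IsProbabilityMeasure (chiSquare d) :=
  Measure.isProbabilityMeasure_map
    (Measurable.aemeasurable (by fun_prop))

section Sample

/- The sample is `x 0, …, x (n - 1)`, so that the observation with (one-based) number `j` is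
`x (j - 1)`, and the observations numbered `a + 1, …, b` are the `x j` with `j ∈ Finset.Ico a b`. -/

/-- The rank of the `k`-th coordinate of `x j` among the `k`-th coordinates of the sample. -/
noncomputable def rank {K : ℕ} (n : ℕ) (x : ℕ → Fin K → ℝ) (k : Fin K) (j : ℕ) : ℕ :=
  ((Finset.range n).filter fun i => x i k ≤ x j k).card

/-- The empirical cumulative distribution function of the `k`-th coordinate of the sample. -/
noncomputable def empCDF {K : ℕ} (n : ℕ) (x : ℕ → Fin K → ℝ) (k : Fin K) (s : ℝ) : ℝ :=
  (n : ℝ)⁻¹ * (((Finset.range n).filter fun j => x j k ≤ s).card : ℝ)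

/-- The empirical covariance matrix `Σ̂_n`. -/
noncomputable def empSigma {K : ℕ} (n : ℕ) (x : ℕ → Fin K → ℝ) : Matrix (Fin K) (Fin K) ℝ :=
  Matrix.of fun k k' => (4 / (n : ℝ)) *
    ∑ i ∈ Finset.range n, (empCDF n x k (x i k) - 1 / 2) * (empCDF n x k' (x i k') - 1 / 2)

/-- The vector of the centred average ranks, coordinate by coordinate, of the group of the
observations numbered `a + 1, …, b`. -/
noncomputable def centredMeanRank {K : ℕ} (n : ℕ) (x : ℕ → Fin K → ℝ) (a b : ℕ) : Fin K → ℝ :=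
  fun k => ((b : ℝ) - (a : ℝ))⁻¹ * (∑ j ∈ Finset.Ico a b, (rank n x k j : ℝ)) - ((n : ℝ) + 1) / 2

/-- The multivariate Kruskal–Wallis statistic of the sample `x 0, …, x (n - 1)`, split into `L`
groups; group `ℓ` consists of the observations numbered `N ℓ + 1, …, N (ℓ + 1)`. -/
noncomputable def statistic {K L : ℕ} (n : ℕ) (N : Fin (L + 1) → ℕ) (x : ℕ → Fin K → ℝ) : ℝ :=
  (4 / (n : ℝ) ^ 2) * ∑ l : Fin L, ((N l.succ : ℝ) - (N l.castSucc : ℝ)) *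
    (centredMeanRank n x (N l.castSucc) (N l.succ) ⬝ᵥ
      Matrix.mulVec (empSigma n x)⁻¹ (centredMeanRank n x (N l.castSucc) (N l.succ)))

end Sample

/-- The cumulative distribution function of the `k`-th coordinate of the random vector `Y`. -/
noncomputable def marginalCDF {Ω : Type*} [MeasurableSpace Ω] {K : ℕ} (P : Measure Ω)
    (Y : Ω → Fin K → ℝ) (k : Fin K) : ℝ → ℝ :=
  fun s => cdf (P.map fun ω => Y ω k) s

/-- The matrix `Σ` with the entries `4 cov (F_k (Y_k), F_k' (Y_k'))`, where `F_k` is the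
cumulative distribution function of the `k`-th coordinate of the random vector `Y`. -/
noncomputable def sigma {Ω : Type*} [MeasurableSpace Ω] {K : ℕ} (P : Measure Ω)
    (Y : Ω → Fin K → ℝ) : Matrix (Fin K) (Fin K) ℝ :=
  Matrix.of fun k k' => 4 *
    covariance (fun ω => marginalCDF P Y k (Y ω k)) (fun ω => marginalCDF P Y k' (Y ω k')) P

end KruskalWallis

/-! The ranks are replaced by the true distribution functions by means of a Hájek projection. With
`F` continuous, `1 (x ≤ y) = F y - F x + 1/2 + rankKernel x y`, and `rankKernel` integrates to zero
in each variable separately. Summed over `x` in the sample and `y` in a group of size `m`, this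
expresses the rank sum of the group through sums of `F (X_j)`, up to a sum of kernels over pairs of
distinct indices (`scaled_mean_rank_eq`). Two kernels are uncorrelated unless they use the same two
indices, so that the remainder, after scaling, has second moment `O(1/n)`
(`tendstoInMeasure_sum_rankKernel`).

Factor `Σ = Bᵀ B` and whiten the scores `2 F - 1` by `(Bᵀ)⁻¹`. The normalized whitened group sums
`W_ℓ` converge jointly to a standard Gaussian vector in `ℝ^(L × K)`
(`tendstoInDistribution_blockSum`), and `2 √m_ℓ / n` times the centred mean rank of group `ℓ` is `Bᵀ
(W_ℓ - s_ℓ ∑ s_ℓ' W_ℓ')` plus the remainder, with `s_ℓ = √(m_ℓ / n)`. The matrix `Σ̂_n` tends to `Σ`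
in probability, by the law of large numbers and an `L²` comparison of empirical with true
distribution functions.

For large `n` the statistic is thus one fixed continuous function of the `W_ℓ` and of parameters
converging in probability to constants (`statistic_eq_quadForm`), and Slutsky's theorem applies. In
the limit `B` cancels, and the squared norm of the projection of a standard Gaussian vector onto the
vectors whose contraction with the unit vector `(√t_ℓ)` vanishes remains. That space has dimension
`(L - 1) K`, whence the chi-square law (`map_residualSq_stdGaussian`). -/

namespace KruskalWallis

/-! ### Convergence in probability, and second moments under independence. -/

section Convergence

variable {Ω : Type*} [MeasurableSpace Ω] {P : Measure Ω}

lemma tendstoInMeasure_pi {ι : Type*} [Fintype ι] {Y : ℕ → Ω → ι → ℝ} {c : ι → ℝ}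
    (h : ∀ i, TendstoInMeasure P (fun n ω => Y n ω i) atTop (fun _ => c i)) :
    TendstoInMeasure P Y atTop (fun _ => c) := by
  rw [tendstoInMeasure_iff_dist]
  intro ε hε
  have h0 : Tendsto (fun n => ∑ i, P {ω | ε ≤ dist (Y n ω i) (c i)}) atTop (𝓝 0) := by
    simpa using tendsto_finsetSum Finset.univ
      fun i _ => tendstoInMeasure_iff_dist.1 (h i) ε hε
  refine tendsto_of_tendsto_of_tendsto_of_le_of_le tendsto_const_nhds h0
    (fun _ => zero_le) fun n => ?_
  refine (measure_mono fun ω hω => ?_).trans (measure_biUnion_finset_le Finset.univ _)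
  by_contra hcon
  simp only [Finset.mem_univ, Set.iUnion_true, Set.mem_iUnion, Set.mem_ofPred_eq, not_exists,
    not_le] at hcon
  exact absurd ((dist_pi_lt_iff hε).2 hcon) (not_lt.2 hω)

lemma tendstoInMeasure_comp_of_continuousAt {E F : Type*} [PseudoMetricSpace E]
    [PseudoMetricSpace F] {Y : ℕ → Ω → E} {c : E} {f : E → F} (hf : ContinuousAt f c)
    (h : TendstoInMeasure P Y atTop (fun _ => c)) :
    TendstoInMeasure P (fun n ω => f (Y n ω)) atTop (fun _ => f c) := by
  rw [tendstoInMeasure_iff_dist] at h ⊢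
  intro ε hε
  obtain ⟨δ, hδ, hδ'⟩ := Metric.continuousAt_iff.1 hf ε hε
  refine tendsto_of_tendsto_of_tendsto_of_le_of_le tendsto_const_nhds (h δ hδ)
    (fun _ => zero_le) fun n => measure_mono fun ω hω => ?_
  by_contra hcon
  exact absurd (hδ' (not_le.1 hcon)) (not_lt.2 hω)

lemma tendstoInMeasure_const_of_tendsto {E : Type*} [PseudoMetricSpace E] {u : ℕ → E} {c : E}
    (h : Tendsto u atTop (𝓝 c)) :
    TendstoInMeasure P (fun n _ => u n) atTop (fun _ => c) := by
  rw [tendstoInMeasure_iff_dist]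
  intro ε hε
  refine tendsto_const_nhds.congr' ?_
  filter_upwards [Metric.tendsto_nhds.1 h ε hε] with n hn
  simp [not_le.2 hn]

/-- Chebyshev's inequality. -/
lemma tendstoInMeasure_zero_of_integral_sq [IsFiniteMeasure P] {D : ℕ → Ω → ℝ}
    (hi : ∀ n, Integrable (fun ω => D n ω ^ 2) P)
    (h : Tendsto (fun n => ∫ ω, D n ω ^ 2 ∂P) atTop (𝓝 0)) :
    TendstoInMeasure P D atTop (fun _ => 0) := by
  rw [tendstoInMeasure_iff_measureReal_norm]
  intro ε hε
  have h0 : Tendsto (fun n => (ε ^ 2)⁻¹ * ∫ ω, D n ω ^ 2 ∂P) atTop (𝓝 0) := by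
    simpa using h.const_mul (ε ^ 2)⁻¹
  refine tendsto_of_tendsto_of_tendsto_of_le_of_le tendsto_const_nhds h0
    (fun _ => measureReal_nonneg) fun n => ?_
  have h1 := mul_meas_ge_le_integral_of_nonneg (ae_of_all P fun ω => sq_nonneg (D n ω)) (hi n)
    (ε ^ 2)
  have h2 : {ω | ε ≤ ‖D n ω - 0‖} = {ω | ε ^ 2 ≤ D n ω ^ 2} := by
    ext ω
    simp only [sub_zero, Real.norm_eq_abs, Set.mem_ofPred_eq]
    rw [sq_le_sq, abs_of_pos hε]
  rw [h2, le_inv_mul_iff₀ (by positivity)]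
  exact h1

lemma integrable_of_abs_le [IsFiniteMeasure P] {f : Ω → ℝ} (hf : Measurable f) {C : ℝ}
    (hb : ∀ ω, |f ω| ≤ C) : Integrable f P :=
  Integrable.of_bound hf.aestronglyMeasurable C (ae_of_all _ hb)

/-- A second moment bound for a sum of bounded variables that are mostly uncorrelated. -/
lemma integral_sq_sum_le [IsProbabilityMeasure P] {ι : Type*} [DecidableEq ι] (A : Finset ι)
    (f : ι → Ω → ℝ) (hm : ∀ a, Measurable (f a)) {C : ℝ} (hb : ∀ a ω, |f a ω| ≤ C)
    (r : ι → Finset ι) (c : ℕ) (hr : ∀ a ∈ A, (r a).card ≤ c)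
    (h0 : ∀ a ∈ A, ∀ b ∈ A, b ∉ r a → ∫ ω, f a ω * f b ω ∂P = 0) :
    ∫ ω, (∑ a ∈ A, f a ω) ^ 2 ∂P ≤ A.card * (c * C ^ 2) := by
  have hC : ∀ a b ω, |f a ω * f b ω| ≤ C ^ 2 := fun a b ω => by
    rw [abs_mul, sq]
    exact mul_le_mul (hb a ω) (hb b ω) (abs_nonneg _) ((abs_nonneg _).trans (hb a ω))
  have hint : ∀ a b, Integrable (fun ω => f a ω * f b ω) P := fun a b =>
    integrable_of_abs_le ((hm a).mul (hm b)) (hC a b)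
  have hle : ∀ a b, ∫ ω, f a ω * f b ω ∂P ≤ C ^ 2 := fun a b => by
    calc ∫ ω, f a ω * f b ω ∂P ≤ ∫ _, C ^ 2 ∂P :=
          integral_mono (hint a b) (integrable_const _) fun ω => (abs_le.1 (hC a b ω)).2
      _ = C ^ 2 := by simp
  simp_rw [sq, Finset.sum_mul_sum]
  rw [integral_finsetSum _ fun a _ => integrable_finsetSum _ fun b _ => hint a b]
  rw [← nsmul_eq_mul]
  refine Finset.sum_le_card_nsmul _ _ _ fun a ha => ?_
  rw [integral_finsetSum _ fun b _ => hint a b]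
  calc ∑ b ∈ A, ∫ ω, f a ω * f b ω ∂P
      = ∑ b ∈ A ∩ r a, ∫ ω, f a ω * f b ω ∂P := by
        refine (Finset.sum_subset Finset.inter_subset_left fun b hb hb' => ?_).symm
        exact h0 a ha b hb fun h => hb' (Finset.mem_inter.2 ⟨hb, h⟩)
    _ ≤ (A ∩ r a).card • C ^ 2 := Finset.sum_le_card_nsmul _ _ _ fun b _ => hle a b
    _ ≤ c * (C * C) := by
        rw [nsmul_eq_mul, ← sq]
        gcongr
        exact (Finset.card_le_card Finset.inter_subset_right).trans (hr a ha)

lemma integral_eq_zero_of_indepFun [IsProbabilityMeasure P] {α β : Type*} [MeasurableSpace α]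
    [MeasurableSpace β] {U : Ω → α} {V : Ω → β} (hU : Measurable U) (hV : Measurable V)
    (h : IndepFun U V P) {φ : α × β → ℝ} (hφ : Measurable φ) {C : ℝ} (hb : ∀ z, |φ z| ≤ C)
    (h0 : ∀ u, ∫ v, φ (u, v) ∂(P.map V) = 0) : ∫ ω, φ (U ω, V ω) ∂P = 0 := by
  have := Measure.isProbabilityMeasure_map (μ := P) hU.aemeasurable
  have := Measure.isProbabilityMeasure_map (μ := P) hV.aemeasurable
  rw [← integral_map (φ := fun ω => (U ω, V ω)) (hU.prodMk hV).aemeasurable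
    hφ.aestronglyMeasurable, h.map_prod_eq_prod_map_map hU.aemeasurable hV.aemeasurable,
    integral_prod _ (integrable_of_abs_le hφ hb)]
  simp [h0]

/-- If `g` integrates to zero in its second variable, then `g (ξ q, ξ a)` is uncorrelated with every
function of variables other than `ξ a`. -/
lemma integral_mul_eq_zero_of_iIndepFun [IsProbabilityMeasure P] {ξ : ℕ → Ω → ℝ}
    (hξ : ∀ i, Measurable (ξ i)) (hind : iIndepFun ξ P) {μ : Measure ℝ}
    (hlaw : ∀ i, P.map (ξ i) = μ) {f g : ℝ → ℝ → ℝ} (hf : Measurable fun z : ℝ × ℝ => f z.1 z.2)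
    (hg : Measurable fun z : ℝ × ℝ => g z.1 z.2) {C : ℝ} (hfb : ∀ x y, |f x y| ≤ C)
    (hgb : ∀ x y, |g x y| ≤ C) (h0 : ∀ x, ∫ y, g x y ∂μ = 0) {i p q a : ℕ} (hi : i ≠ a)
    (hp : p ≠ a) (hq : q ≠ a) :
    ∫ ω, f (ξ i ω) (ξ p ω) * g (ξ q ω) (ξ a ω) ∂P = 0 := by
  have hd : Disjoint ({i, p, q} : Finset ℕ) {a} := by simp [hi.symm, hp.symm, hq.symm]
  have hU : Measurable fun ω (s : ({i, p, q} : Finset ℕ)) => ξ s ω := by fun_prop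
  have hπ : Measurable fun v : ({a} : Finset ℕ) → ℝ => v ⟨a, by simp⟩ := measurable_pi_apply _
  have hI : IndepFun (fun ω (s : ({i, p, q} : Finset ℕ)) => ξ s ω) (ξ a) P :=
    (hind.indepFun_finset _ _ hd hξ).comp measurable_id hπ
  let φ : (({i, p, q} : Finset ℕ) → ℝ) × ℝ → ℝ := fun z =>
    f (z.1 ⟨i, by simp⟩) (z.1 ⟨p, by simp⟩) * g (z.1 ⟨q, by simp⟩) z.2
  have hφ : Measurable φ := by
    refine Measurable.mul ?_ ?_
    · exact hf.comp (f := fun z : (({i, p, q} : Finset ℕ) → ℝ) × ℝ =>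
        (z.1 ⟨i, by simp⟩, z.1 ⟨p, by simp⟩)) (by fun_prop)
    · exact hg.comp (f := fun z : (({i, p, q} : Finset ℕ) → ℝ) × ℝ =>
        (z.1 ⟨q, by simp⟩, z.2)) (by fun_prop)
  refine integral_eq_zero_of_indepFun (φ := φ) (C := C * C) hU (hξ a) hI hφ (fun z => ?_)
    fun u => ?_
  · rw [abs_mul]
    exact mul_le_mul (hfb _ _) (hgb _ _) (abs_nonneg _) ((abs_nonneg _).trans (hfb 0 0))
  · rw [hlaw]
    simp only [φ]
    rw [integral_const_mul, h0, mul_zero]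

end Convergence

/-! ### Joint central limit theorem for sums over disjoint blocks. -/

section GroupCLT

variable {Ω : Type*} [MeasurableSpace Ω] {P : Measure Ω}

lemma charFun_map_eq_charFun_map_inner {E : Type*} [NormedAddCommGroup E] [InnerProductSpace ℝ E]
    [MeasurableSpace E] [BorelSpace E] [SecondCountableTopology E] {W : Ω → E} (hW : Measurable W)
    (t : E) : charFun (P.map W) t = charFun (P.map fun ω => inner ℝ (W ω) t) 1 := by
  rw [charFun_apply, charFun_apply_real, integral_map hW.aemeasurable (by fun_prop),
    integral_map (by fun_prop) (by fun_prop)]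
  simp

/-- The vector of the normalized sums of an i.i.d. sequence over disjoint blocks. -/
noncomputable def blockSum {K L : ℕ} (G : Fin L → Finset ℕ) (Z : ℕ → Fin K → ℝ) :
    EuclideanSpace ℝ (Fin L × Fin K) :=
  WithLp.toLp 2 fun q => (√(G q.1).card)⁻¹ * ∑ j ∈ G q.1, Z j q.2

lemma measurable_blockSum {K L : ℕ} (G : Fin L → Finset ℕ) {Z : ℕ → Ω → Fin K → ℝ}
    (hZ : ∀ i, Measurable (Z i)) : Measurable fun ω => blockSum G fun i => Z i ω := by
  refine (WithLp.measurable_toLp 2 _).comp (measurable_pi_iff.2 fun q => ?_)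
  fun_prop

/-- The inner product with `t` is a sum of independent real variables indexed by the pairs (block,
index in the block). Disjointness of the blocks makes these indices distinct, and within a block all
factors agree. -/
lemma charFun_map_blockSum {K L : ℕ} {Z : ℕ → Ω → Fin K → ℝ} (hZ : ∀ i, Measurable (Z i))
    (hind : iIndepFun Z P) (hid : ∀ i, IdentDistrib (Z i) (Z 0) P P) {G : Fin L → Finset ℕ}
    (hG : Pairwise fun l l' => Disjoint (G l) (G l')) (t : EuclideanSpace ℝ (Fin L × Fin K)) :
    charFun (P.map fun ω => blockSum G fun i => Z i ω) t =
      ∏ l, charFun (P.map fun ω => ∑ k, t (l, k) * Z 0 ω k) (√(G l).card)⁻¹ ^ (G l).card := by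
  rw [charFun_map_eq_charFun_map_inner (measurable_blockSum G hZ)]
  let e : (Σ l, G l) → ℕ := fun x => x.2
  have he : Function.Injective e := by
    rintro ⟨l, j, hj⟩ ⟨l', j', hj'⟩ (rfl : j = j')
    obtain rfl : l = l' := by
      by_contra hne
      exact Finset.disjoint_left.1 (hG hne) hj hj'
    rfl
  let c : Fin L → (Fin K → ℝ) → ℝ := fun l z => (√(G l).card)⁻¹ * ∑ k, t (l, k) * z k
  have hc : ∀ l, Measurable (c l) := fun l => by fun_prop
  have hV := (hind.precomp he).comp (fun x => c x.1) fun x => hc x.1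
  have hsum : (fun ω => inner ℝ (blockSum G fun i => Z i ω) t) =
      fun ω => ∑ x : Σ l, G l, ((c x.1) ∘ (Z (e x))) ω := by
    ext ω
    rw [Fintype.sum_sigma]
    simp only [PiLp.inner_apply, Fintype.sum_prod_type, blockSum, RCLike.inner_apply, conj_trivial,
      Function.comp_apply, c, e]
    refine Finset.sum_congr rfl fun l _ => ?_
    rw [← Finset.mul_sum, Finset.sum_coe_sort (G l) fun j => ∑ k, t (l, k) * Z j ω k,
      Finset.sum_comm, Finset.mul_sum]
    refine Finset.sum_congr rfl fun k _ => ?_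
    rw [← Finset.mul_sum]
    ring
  rw [hsum, hV.charFun_map_fun_sum_eq_prod fun x => ((hc _).comp (hZ _)).aemeasurable,
    Finset.prod_apply, Fintype.prod_sigma]
  refine Finset.prod_congr rfl fun l _ => ?_
  have : ∀ j : G l, charFun (P.map (c l ∘ Z (e ⟨l, j⟩))) 1 =
      charFun (P.map fun ω => ∑ k, t (l, k) * Z 0 ω k) (√(G l).card)⁻¹ := fun j => by
    rw [((hid (e ⟨l, j⟩)).comp (hc l)).map_eq]
    have := charFun_map_mul_comp (μ := P) (f := fun ω => ∑ k, t (l, k) * Z 0 ω k)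
      (by fun_prop) (√(G l).card)⁻¹ 1
    rw [mul_one] at this
    exact this
  simp [this]

variable [IsProbabilityMeasure P]

/-- The one-dimensional central limit theorem for the projection on `u`, rescaled to unit variance
by `r = ‖u‖` and evaluated at `r`; the case `u = 0` is separate because it cannot be rescaled. -/
lemma tendsto_charFun_linear_pow {K : ℕ} {Z : Ω → Fin K → ℝ} (hZ : Measurable Z)
    (hmean : ∀ u : Fin K → ℝ, ∫ ω, ∑ k, u k * Z ω k ∂P = 0)
    (hvar : ∀ u : Fin K → ℝ, ∫ ω, (∑ k, u k * Z ω k) ^ 2 ∂P = ∑ k, u k ^ 2) (u : Fin K → ℝ) :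
    Tendsto (fun m : ℕ => charFun (P.map fun ω => ∑ k, u k * Z ω k) (√m)⁻¹ ^ m) atTop
      (𝓝 (Complex.exp (-(∑ k, u k ^ 2 : ℝ) / 2))) := by
  rcases (Finset.sum_nonneg fun k (_ : k ∈ Finset.univ) => sq_nonneg (u k)).eq_or_lt with h | h
  · have hu : ∀ k, u k = 0 := fun k => by
      simpa using (Finset.sum_eq_zero_iff_of_nonneg fun k _ => sq_nonneg (u k)).1 h.symm k
        (Finset.mem_univ k)
    simp [hu]
  · set r : ℝ := √(∑ k, u k ^ 2) with hr
    have hr0 : 0 < r := Real.sqrt_pos.2 h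
    have hr2 : r ^ 2 = ∑ k, u k ^ 2 := Real.sq_sqrt h.le
    have hX : Measurable fun ω => ∑ k, u k / r * Z ω k := by fun_prop
    have h1 : ∫ ω, (∑ k, u k / r * Z ω k) ^ 2 ∂P = 1 := by
      rw [hvar fun k => u k / r]
      simp_rw [div_pow]
      rw [← Finset.sum_div, ← hr2, div_self (by positivity)]
    have key := tendsto_charFun_inv_sqrt_mul_pow hX.aemeasurable (hmean fun k => u k / r)
      (by simpa using h1) r
    have h2 : (fun ω => ∑ k, u k * Z ω k) = fun ω => r * ∑ k, u k / r * Z ω k := by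
      ext ω
      rw [Finset.mul_sum]
      refine Finset.sum_congr rfl fun k _ => ?_
      field_simp
    rw [h2]
    simp_rw [charFun_map_mul_comp hX.aemeasurable, mul_comm r]
    rw [← hr2]
    simpa using key

/-- The central limit theorem for the vector of the normalized sums over disjoint growing blocks of
an i.i.d. sequence of centred random vectors with unit covariance matrix. -/
theorem tendstoInDistribution_blockSum {K L : ℕ} {Z : ℕ → Ω → Fin K → ℝ}
    (hZ : ∀ i, Measurable (Z i))
    (hind : iIndepFun Z P) (hid : ∀ i, IdentDistrib (Z i) (Z 0) P P)
    (hmean : ∀ u : Fin K → ℝ, ∫ ω, ∑ k, u k * Z 0 ω k ∂P = 0)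
    (hvar : ∀ u : Fin K → ℝ, ∫ ω, (∑ k, u k * Z 0 ω k) ^ 2 ∂P = ∑ k, u k ^ 2)
    {G : ℕ → Fin L → Finset ℕ}
    (hG : ∀ᶠ n in atTop, Pairwise fun l l' => Disjoint (G n l) (G n l'))
    (hcard : ∀ l, Tendsto (fun n => (G n l).card) atTop atTop) :
    TendstoInDistribution (fun n ω => blockSum (G n) fun i => Z i ω) atTop id (fun _ => P)
      (stdGaussian (EuclideanSpace ℝ (Fin L × Fin K))) where
  forall_aemeasurable n := (measurable_blockSum (G n) hZ).aemeasurable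
  tendsto := by
    refine ProbabilityMeasure.tendsto_iff_tendsto_charFun.2 fun t => ?_
    simp only [ProbabilityMeasure.coe_mk, Measure.map_id, charFun_stdGaussian]
    have h1 : Complex.exp (-(‖t‖ : ℂ) ^ 2 / 2) =
        ∏ l, Complex.exp (-(∑ k, t (l, k) ^ 2 : ℝ) / 2) := by
      rw [← Complex.exp_sum, ← Finset.sum_div, Finset.sum_neg_distrib, ← Complex.ofReal_sum,
        ← Complex.ofReal_pow, EuclideanSpace.real_norm_sq_eq, Fintype.sum_prod_type]
    rw [h1]
    refine (tendsto_finsetProd Finset.univ fun l _ => (tendsto_charFun_linear_pow (hZ 0) hmean hvar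
      fun k => t (l, k)).comp (hcard l)).congr' ?_
    filter_upwards [hG] with n hn
    rw [charFun_map_blockSum hZ hind hid hn]
    rfl

end GroupCLT

/-! ### Gaussian projections and the chi-square law. -/

section ProjectionLaw

lemma map_norm_sq_stdGaussian {E : Type*} [NormedAddCommGroup E] [InnerProductSpace ℝ E]
    [FiniteDimensional ℝ E] [MeasurableSpace E] [BorelSpace E] :
    (stdGaussian E).map (fun x => ‖x‖ ^ 2) = chiSquare (Module.finrank ℝ E) := by
  rw [stdGaussian, Measure.map_map (by fun_prop) (by fun_prop), chiSquare]
  congr 1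
  ext x
  simp only [Function.comp_apply]
  rw [← (stdOrthonormalBasis ℝ E).sum_sq_inner_right]
  refine Finset.sum_congr rfl fun i _ => ?_
  rw [(stdOrthonormalBasis ℝ E).orthonormal.inner_right_fintype]

/-- The projection is adjoint to the inclusion of `U`, which preserves the norm, and the Gaussian
characteristic function depends on the norm only. -/
lemma map_orthogonalProjection_stdGaussian {E : Type*} [NormedAddCommGroup E]
    [InnerProductSpace ℝ E] [FiniteDimensional ℝ E] [MeasurableSpace E] [BorelSpace E]
    (U : Submodule ℝ E) :
    (stdGaussian E).map U.orthogonalProjectionOnto = stdGaussian U := by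
  refine Measure.ext_of_charFun (funext fun t => ?_)
  rw [charFun_stdGaussian, charFun_apply, integral_map (by fun_prop) (by fun_prop)]
  simp_rw [Submodule.inner_orthogonalProjectionOnto_eq_of_mem_right]
  rw [← charFun_apply, charFun_stdGaussian]
  simp

/-- The squared norm of the residual of `x` after the projection on the direction `s` of the first
index. -/
noncomputable def residualSq {K L : ℕ} (s : Fin L → ℝ) (x : EuclideanSpace ℝ (Fin L × Fin K)) : ℝ :=
  ∑ l, ∑ k, (x (l, k) - s l * ∑ l', s l' * x (l', k)) ^ 2

/-- The linear map contracting the first index with `s`. -/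
noncomputable def contract {K L : ℕ} (s : Fin L → ℝ) :
    EuclideanSpace ℝ (Fin L × Fin K) →ₗ[ℝ] (Fin K → ℝ) where
  toFun x k := ∑ l, s l * x (l, k)
  map_add' x y := by
    ext k
    simp [mul_add, Finset.sum_add_distrib]
  map_smul' c x := by
    ext k
    simp [Finset.mul_sum, mul_left_comm]

/-- Rank–nullity: since `s` is a unit vector, `y ↦ s ⊗ y` is a right inverse of the contraction,
whose rank is therefore `K`. -/
lemma finrank_ker_contract {K L : ℕ} {s : Fin L → ℝ} (hs : ∑ l, s l ^ 2 = 1) :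
    Module.finrank ℝ (LinearMap.ker (contract (K := K) s)) = (L - 1) * K := by
  have h := LinearMap.finrank_range_add_finrank_ker (contract (K := K) s)
  have hsurj : LinearMap.range (contract (K := K) s) = ⊤ := by
    refine LinearMap.range_eq_top.2 fun y => ⟨WithLp.toLp 2 fun q => s q.1 * y q.2, ?_⟩
    ext k
    simp only [contract, LinearMap.coe_mk, AddHom.coe_mk]
    simp_rw [← mul_assoc, ← sq]
    rw [← Finset.sum_mul, hs, one_mul]
  rw [hsurj] at h
  simp only [finrank_top, Module.finrank_fintype_fun_eq_card, Fintype.card_fin,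
    finrank_euclideanSpace, Fintype.card_prod] at h
  rw [Nat.sub_mul, one_mul]
  omega

lemma norm_sq_orthogonalProjection_ker_contract {K L : ℕ} {s : Fin L → ℝ}
    (hs : ∑ l, s l ^ 2 = 1) (x : EuclideanSpace ℝ (Fin L × Fin K)) :
    ‖(LinearMap.ker (contract (K := K) s)).orthogonalProjectionOnto x‖ ^ 2 = residualSq s x := by
  -- The candidate for the projection: `x - v` is `s` tensored with the contraction of `x`, hence
  -- orthogonal to the kernel.
  let v : EuclideanSpace ℝ (Fin L × Fin K) :=
    WithLp.toLp 2 fun q => x q - s q.1 * ∑ l', s l' * x (l', q.2)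
  have hv : v ∈ LinearMap.ker (contract (K := K) s) := by
    rw [LinearMap.mem_ker]
    ext k
    simp only [contract, LinearMap.coe_mk, AddHom.coe_mk, v, mul_sub, Finset.sum_sub_distrib,
      Pi.zero_apply]
    simp_rw [← mul_assoc, ← sq]
    rw [← Finset.sum_mul, hs, one_mul, sub_self]
  have hort : x - v ∈ (LinearMap.ker (contract (K := K) s))ᗮ := by
    rw [Submodule.mem_orthogonal']
    intro y hy
    have hy' : ∀ k, ∑ l, s l * y (l, k) = 0 := fun k => congrFun (LinearMap.mem_ker.1 hy) k
    simp only [PiLp.inner_apply, Fintype.sum_prod_type, RCLike.inner_apply, conj_trivial, v,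
      PiLp.sub_apply, sub_sub_cancel]
    rw [Finset.sum_comm]
    refine Finset.sum_eq_zero fun k _ => ?_
    calc ∑ l, y (l, k) * (s l * ∑ l', s l' * x (l', k))
        = (∑ l, s l * y (l, k)) * ∑ l', s l' * x (l', k) := by
          rw [Finset.sum_mul]
          exact Finset.sum_congr rfl fun l _ => by ring
      _ = 0 := by rw [hy', zero_mul]
  have h := Submodule.eq_starProjection_of_mem_orthogonal hv hort
  have h2 : ‖(LinearMap.ker (contract (K := K) s)).orthogonalProjectionOnto x‖ = ‖v‖ := by
    rw [← h]
    rfl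
  rw [h2, EuclideanSpace.real_norm_sq_eq, Fintype.sum_prod_type]
  rfl

theorem map_residualSq_stdGaussian {K L : ℕ} {s : Fin L → ℝ} (hs : ∑ l, s l ^ 2 = 1) :
    (stdGaussian (EuclideanSpace ℝ (Fin L × Fin K))).map (residualSq s) =
      chiSquare ((L - 1) * K) := by
  have h : residualSq (K := K) s = (fun y => ‖y‖ ^ 2) ∘
      (LinearMap.ker (contract (K := K) s)).orthogonalProjectionOnto :=
    funext fun x => (norm_sq_orthogonalProjection_ker_contract hs x).symm
  rw [h, ← Measure.map_map (by fun_prop) (by fun_prop), map_orthogonalProjection_stdGaussian,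
    map_norm_sq_stdGaussian, finrank_ker_contract hs]

end ProjectionLaw

/-! ### Degenerate kernels and their second moments. -/

section Kernels

variable {μ : Measure ℝ}

lemma abs_cdf_le_one (x : ℝ) : |cdf μ x| ≤ 1 :=
  abs_le.2 ⟨by linarith [cdf_nonneg μ x], cdf_le_one μ x⟩

lemma measurable_ite_le : Measurable fun z : ℝ × ℝ => if z.1 ≤ z.2 then (1 : ℝ) else 0 :=
  Measurable.ite (measurableSet_le measurable_fst measurable_snd) measurable_const measurable_const

lemma abs_ite_le_one (p : Prop) [Decidable p] : |if p then (1 : ℝ) else 0| ≤ 1 := by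
  split_ifs <;> simp

lemma measurable_cdf : Measurable (cdf μ) := (monotone_cdf μ).measurable

/-- The remainder of the Hájek projection of the kernel `1 (x ≤ y)`. -/
noncomputable def rankKernel (μ : Measure ℝ) (x y : ℝ) : ℝ :=
  (if x ≤ y then 1 else 0) - cdf μ y + cdf μ x - 1 / 2

/-- The centred kernel of the empirical distribution function, evaluated at `x`. -/
noncomputable def cdfKernel (μ : Measure ℝ) (x y : ℝ) : ℝ :=
  (if y ≤ x then 1 else 0) - cdf μ x

lemma measurable_rankKernel : Measurable fun z : ℝ × ℝ => rankKernel μ z.1 z.2 :=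
  ((measurable_ite_le.sub (measurable_cdf.comp measurable_snd)).add
    (measurable_cdf.comp measurable_fst)).sub measurable_const

lemma measurable_cdfKernel : Measurable fun z : ℝ × ℝ => cdfKernel μ z.1 z.2 :=
  (measurable_ite_le.comp measurable_swap).sub (measurable_cdf.comp measurable_fst)

lemma abs_rankKernel_le (x y : ℝ) : |rankKernel μ x y| ≤ 2 := by
  have h1 := cdf_nonneg μ x
  have h2 := cdf_le_one μ x
  have h3 := cdf_nonneg μ y
  have h4 := cdf_le_one μ y
  unfold rankKernel
  split_ifs <;> exact abs_le.2 ⟨by linarith, by linarith⟩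

lemma abs_cdfKernel_le (x y : ℝ) : |cdfKernel μ x y| ≤ 1 := by
  have h1 := cdf_nonneg μ x
  have h2 := cdf_le_one μ x
  unfold cdfKernel
  split_ifs <;> exact abs_le.2 ⟨by linarith, by linarith⟩

variable [IsProbabilityMeasure μ]

lemma integral_ite_le_left (y : ℝ) : ∫ x, (if x ≤ y then (1 : ℝ) else 0) ∂μ = cdf μ y := by
  have h : (fun x => if x ≤ y then (1 : ℝ) else 0) = (Set.Iic y).indicator 1 := by
    ext x
    simp [Set.indicator_apply]
  rw [h, integral_indicator_one measurableSet_Iic, cdf_eq_real]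

lemma measure_singleton_eq_zero_of_continuous_cdf (hF : Continuous (cdf μ)) (x : ℝ) :
    μ {x} = 0 := by
  rw [← measure_cdf μ, StieltjesFunction.measure_singleton,
    hF.continuousAt.continuousWithinAt.leftLim_eq, sub_self, ENNReal.ofReal_zero]

/-- Continuity rules out an atom at `x`, so that `≤` and `<` have the same probability. -/
lemma integral_ite_le_right (hF : Continuous (cdf μ)) (x : ℝ) :
    ∫ y, (if x ≤ y then (1 : ℝ) else 0) ∂μ = 1 - cdf μ x := by
  have h : (fun y => if x ≤ y then (1 : ℝ) else 0) =ᵐ[μ] (Set.Iic x)ᶜ.indicator 1 := by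
    have hne : ∀ᵐ y ∂μ, y ≠ x := by
      rw [ae_iff]
      simpa using measure_singleton_eq_zero_of_continuous_cdf hF x
    filter_upwards [hne] with y hy
    have : x ≤ y ↔ x < y := ⟨fun h => lt_of_le_of_ne h hy.symm, le_of_lt⟩
    simp [Set.indicator_apply, this]
  rw [integral_congr_ae h, integral_indicator_one measurableSet_Iic.compl,
    probReal_compl_eq_one_sub measurableSet_Iic, cdf_eq_real]

lemma integrable_cdf : Integrable (cdf μ) μ := integrable_of_abs_le measurable_cdf abs_cdf_le_one

/-- Integrating `1 (x ≤ y)` in both orders gives `∫ F = 1 - ∫ F`. -/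
lemma integral_cdf_self (hF : Continuous (cdf μ)) : ∫ x, cdf μ x ∂μ = 1 / 2 := by
  have hint : Integrable (fun z : ℝ × ℝ => if z.1 ≤ z.2 then (1 : ℝ) else 0) (μ.prod μ) :=
    integrable_of_abs_le measurable_ite_le fun z => abs_ite_le_one _
  have h := integral_integral_swap (f := fun x y => if x ≤ y then (1 : ℝ) else 0) hint
  simp_rw [integral_ite_le_left, integral_ite_le_right hF] at h
  rw [integral_sub (integrable_const _) integrable_cdf] at h
  simp only [integral_const, probReal_univ, smul_eq_mul, mul_one] at h
  linarith

lemma integral_rankKernel_right (hF : Continuous (cdf μ)) (x : ℝ) :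
    ∫ y, rankKernel μ x y ∂μ = 0 := by
  have h1 : Integrable (fun y => if x ≤ y then (1 : ℝ) else 0) μ :=
    integrable_of_abs_le (measurable_ite_le.comp (measurable_const.prodMk measurable_id))
      fun y => abs_ite_le_one _
  have h2 : Integrable (fun y => (if x ≤ y then (1 : ℝ) else 0) - cdf μ y) μ :=
    h1.sub integrable_cdf
  have h3 : Integrable (fun y => (if x ≤ y then (1 : ℝ) else 0) - cdf μ y + cdf μ x) μ :=
    h2.add (integrable_const _)
  unfold rankKernel
  rw [integral_sub h3 (integrable_const _), integral_add h2 (integrable_const _),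
    integral_sub h1 integrable_cdf, integral_ite_le_right hF, integral_cdf_self hF]
  simp
  ring

lemma integrable_ite_le_left (y : ℝ) : Integrable (fun x => if x ≤ y then (1 : ℝ) else 0) μ :=
  integrable_of_abs_le (measurable_ite_le.comp (measurable_id.prodMk measurable_const))
    fun _ => abs_ite_le_one _

lemma integral_rankKernel_left (hF : Continuous (cdf μ)) (y : ℝ) :
    ∫ x, rankKernel μ x y ∂μ = 0 := by
  have h1 := integrable_ite_le_left (μ := μ) y
  have h2 : Integrable (fun x => (if x ≤ y then (1 : ℝ) else 0) - cdf μ y) μ :=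
    h1.sub (integrable_const _)
  have h3 : Integrable (fun x => (if x ≤ y then (1 : ℝ) else 0) - cdf μ y + cdf μ x) μ :=
    h2.add integrable_cdf
  unfold rankKernel
  rw [integral_sub h3 (integrable_const _), integral_add h2 integrable_cdf,
    integral_sub h1 (integrable_const _), integral_ite_le_left, integral_cdf_self hF]
  simp

lemma integral_cdfKernel (x : ℝ) : ∫ y, cdfKernel μ x y ∂μ = 0 := by
  unfold cdfKernel
  rw [integral_sub (integrable_ite_le_left x) (integrable_const _), integral_ite_le_left]
  simp

variable {Ω : Type*} [MeasurableSpace Ω] {P : Measure Ω} [IsProbabilityMeasure P] {ξ : ℕ → Ω → ℝ}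

lemma integral_sq_sum_rankKernel_le (hξ : ∀ i, Measurable (ξ i)) (hind : iIndepFun ξ P)
    (hlaw : ∀ i, P.map (ξ i) = μ) (hF : Continuous (cdf μ)) (A : Finset (ℕ × ℕ))
    (hA : ∀ a ∈ A, a.1 ≠ a.2) :
    ∫ ω, (∑ a ∈ A, rankKernel μ (ξ a.1 ω) (ξ a.2 ω)) ^ 2 ∂P ≤ A.card * 8 := by
  have hflip : Measurable fun z : ℝ × ℝ => rankKernel μ z.2 z.1 :=
    measurable_rankKernel.comp measurable_swap
  refine (integral_sq_sum_le A (fun a ω => rankKernel μ (ξ a.1 ω) (ξ a.2 ω))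
    (fun a => measurable_rankKernel.comp ((hξ a.1).prodMk (hξ a.2)))
    (C := 2) (fun a ω => abs_rankKernel_le _ _) (fun a => {a, a.swap}) 2
    -- The constant 8 is 2 (the pair and its swap) times the squared bound `2 ^ 2`.
    (fun a _ => Finset.card_le_two) fun a ha b hb hab => ?_).trans (by norm_num)
  obtain ⟨i, j⟩ := a
  obtain ⟨i', j'⟩ := b
  have hij : i ≠ j := hA _ ha
  have hij' : i' ≠ j' := hA _ hb
  simp only [Prod.swap_prod_mk, Finset.mem_insert, Prod.mk.injEq, Finset.mem_singleton,
    not_or, not_and] at hab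
  by_cases hj : i ≠ j' ∧ j ≠ j'
  · exact integral_mul_eq_zero_of_iIndepFun hξ hind hlaw measurable_rankKernel
      measurable_rankKernel abs_rankKernel_le abs_rankKernel_le (integral_rankKernel_right hF)
      hj.1 hj.2 hij'
  -- Here `j'` is `i` or `j`. Were `i'` one of them too, `b` would be `a` or its swap; so `i'` is a
  -- fresh index, and the kernel is integrated in its first variable instead.
  · have hi : i ≠ i' ∧ j ≠ i' := by omega
    exact integral_mul_eq_zero_of_iIndepFun (g := fun x y => rankKernel μ y x) hξ hind hlaw
      measurable_rankKernel hflip abs_rankKernel_le (fun x y => abs_rankKernel_le y x)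
      (integral_rankKernel_left hF) hi.1 hi.2 hij'.symm

lemma integral_sq_sum_cdfKernel_le (hξ : ∀ i, Measurable (ξ i)) (hind : iIndepFun ξ P)
    (hlaw : ∀ i, P.map (ξ i) = μ) (A : Finset ℕ) (i : ℕ) :
    ∫ ω, (∑ j ∈ A, cdfKernel μ (ξ i ω) (ξ j ω)) ^ 2 ∂P ≤ A.card := by
  refine (integral_sq_sum_le A (fun j ω => cdfKernel μ (ξ i ω) (ξ j ω))
    (fun j => measurable_cdfKernel.comp ((hξ i).prodMk (hξ j)))
    (C := 1) (fun a ω => abs_cdfKernel_le _ _) (fun a => {a}) 1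
    (fun a _ => by simp) fun a _ b _ hab => ?_).trans (by norm_num)
  have hab' : b ≠ a := by simpa using hab
  by_cases hb : i ≠ b
  · exact integral_mul_eq_zero_of_iIndepFun hξ hind hlaw measurable_cdfKernel
      measurable_cdfKernel abs_cdfKernel_le abs_cdfKernel_le integral_cdfKernel
      hb hab'.symm hb
  -- At most one of the distinct indices `a`, `b` equals `i`; the other one is integrated out.
  · have ha : i ≠ a := by omega
    simp_rw [mul_comm (cdfKernel μ (ξ i _) (ξ a _))]
    exact integral_mul_eq_zero_of_iIndepFun hξ hind hlaw measurable_cdfKernel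
      measurable_cdfKernel abs_cdfKernel_le abs_cdfKernel_le integral_cdfKernel
      ha hab' ha

end Kernels

/-! ### Algebraic identities for ranks and empirical distribution functions. -/

section SampleIdentities

variable {K : ℕ}

lemma rank_eq_sum (n : ℕ) (x : ℕ → Fin K → ℝ) (k : Fin K) (j : ℕ) :
    (rank n x k j : ℝ) = ∑ i ∈ Finset.range n, if x i k ≤ x j k then (1 : ℝ) else 0 := by
  rw [rank, Finset.sum_boole]

lemma empCDF_eq_sum (n : ℕ) (x : ℕ → Fin K → ℝ) (k : Fin K) (s : ℝ) :
    empCDF n x k s = (n : ℝ)⁻¹ * ∑ j ∈ Finset.range n, if x j k ≤ s then (1 : ℝ) else 0 := by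
  rw [empCDF, Finset.sum_boole]

lemma empCDF_mem_Icc (n : ℕ) (x : ℕ → Fin K → ℝ) (k : Fin K) (s : ℝ) :
    empCDF n x k s ∈ Set.Icc (0 : ℝ) 1 := by
  have h : (((Finset.range n).filter fun j => x j k ≤ s).card : ℝ) ≤ n := by
    exact_mod_cast (Finset.card_filter_le _ _).trans (Finset.card_range n).le
  refine ⟨by unfold empCDF; positivity, ?_⟩
  rw [empCDF, ← div_eq_inv_mul]
  exact div_le_one_of_le₀ h (Nat.cast_nonneg n)

lemma empCDF_sub_cdf {n : ℕ} (hn : n ≠ 0) (μ : Measure ℝ) (x : ℕ → Fin K → ℝ) (k : Fin K)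
    (s : ℝ) : empCDF n x k s - cdf μ s =
      (n : ℝ)⁻¹ * ∑ j ∈ Finset.range n, cdfKernel μ s (x j k) := by
  simp only [empCDF_eq_sum, cdfKernel, Finset.sum_sub_distrib, Finset.sum_const, Finset.card_range,
    nsmul_eq_mul]
  field_simp

lemma sq_sum_mul_sub_sum_mul_le (n : ℕ) {p q u v : ℕ → ℝ} (hq : ∀ i, |q i| ≤ 1)
    (hu : ∀ i, |u i| ≤ 1) :
    (∑ i ∈ Finset.range n, p i * q i - ∑ i ∈ Finset.range n, u i * v i) ^ 2 ≤
      n * ∑ i ∈ Finset.range n, 2 * ((p i - u i) ^ 2 + (q i - v i) ^ 2) := by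
  rw [← Finset.sum_sub_distrib]
  refine sq_sum_le_card_mul_sum_sq.trans ?_
  rw [Finset.card_range]
  gcongr with i hi
  have h1 : p i * q i - u i * v i = (p i - u i) * q i + u i * (q i - v i) := by ring
  have h2 : ((p i - u i) * q i) ^ 2 ≤ (p i - u i) ^ 2 := by
    rw [mul_pow]
    exact mul_le_of_le_one_right (sq_nonneg _) ((sq_le_one_iff_abs_le_one _).2 (hq i))
  have h3 : (u i * (q i - v i)) ^ 2 ≤ (q i - v i) ^ 2 := by
    rw [mul_pow]
    exact mul_le_of_le_one_left (sq_nonneg _) ((sq_le_one_iff_abs_le_one _).2 (hu i))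
  rw [h1]
  linarith [add_sq_le (a := (p i - u i) * q i) (b := u i * (q i - v i))]

/-- The pairs of distinct indices with the first one in the sample and the second one in `G`. -/
def offDiagPairs (n : ℕ) (G : Finset ℕ) : Finset (ℕ × ℕ) :=
  (Finset.range n ×ˢ G).filter fun a => a.1 ≠ a.2

lemma card_offDiagPairs_le (n : ℕ) (G : Finset ℕ) : (offDiagPairs n G).card ≤ n * G.card :=
  (Finset.card_filter_le _ _).trans (by simp)

/-- Each diagonal pair contributes exactly `1/2`, because an observation is counted in its own rank.
This is the source of `n + 1`, rather than `n`, in the centring of the ranks. -/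
lemma sum_rankKernel_product {n : ℕ} {G : Finset ℕ} (hG : G ⊆ Finset.range n) (μ : Measure ℝ)
    (ξ : ℕ → ℝ) :
    ∑ a ∈ Finset.range n ×ˢ G, rankKernel μ (ξ a.1) (ξ a.2) =
      ∑ a ∈ offDiagPairs n G, rankKernel μ (ξ a.1) (ξ a.2) + G.card / 2 := by
  rw [offDiagPairs, ← Finset.sum_filter_add_sum_filter_not _ fun a : ℕ × ℕ => a.1 ≠ a.2]
  congr 1
  have h : (Finset.range n ×ˢ G).filter (fun a => ¬ a.1 ≠ a.2) = G.image fun j => (j, j) := by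
    ext ⟨i, j⟩
    simp only [Finset.mem_filter, Finset.mem_product, Finset.mem_image, Prod.mk.injEq, not_not]
    constructor
    · rintro ⟨⟨-, hj⟩, rfl⟩
      exact ⟨i, hj, rfl, rfl⟩
    · rintro ⟨l, hl, rfl, rfl⟩
      exact ⟨⟨hG hl, hl⟩, rfl⟩
  rw [h, Finset.sum_image fun a _ b _ hab => congrArg Prod.fst hab]
  have h2 : ∀ y, rankKernel μ y y = 1 / 2 := fun y => by
    simp only [rankKernel, le_refl, if_true]
    ring
  simp only [h2, Finset.sum_const, nsmul_eq_mul]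
  ring

lemma sum_rank_eq {n : ℕ} {G : Finset ℕ} (hG : G ⊆ Finset.range n) (μ : Measure ℝ)
    (x : ℕ → Fin K → ℝ) (k : Fin K) :
    ∑ j ∈ G, (rank n x k j : ℝ) =
      n * ∑ j ∈ G, cdf μ (x j k) - G.card * ∑ i ∈ Finset.range n, cdf μ (x i k) +
        G.card * (n + 1) / 2 + ∑ a ∈ offDiagPairs n G, rankKernel μ (x a.1 k) (x a.2 k) := by
  have h1 := sum_rankKernel_product hG μ fun i => x i k
  rw [Finset.sum_product_right] at h1
  have h2 : ∑ j ∈ G, ∑ i ∈ Finset.range n, rankKernel μ (x i k) (x j k) =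
      ∑ j ∈ G, (rank n x k j : ℝ) - n * ∑ j ∈ G, cdf μ (x j k) +
        G.card * ∑ i ∈ Finset.range n, cdf μ (x i k) - G.card * n / 2 := by
    simp only [rankKernel, Finset.sum_sub_distrib, Finset.sum_add_distrib, Finset.sum_const,
      nsmul_eq_mul, Finset.card_range, rank_eq_sum, Finset.mul_sum]
    ring
  rw [h2] at h1
  linarith

lemma scaled_mean_rank_eq {n : ℕ} {G : Finset ℕ} (hG : G ⊆ Finset.range n) (hG0 : G.card ≠ 0)
    (μ : Measure ℝ) (x : ℕ → Fin K → ℝ) (k : Fin K) :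
    2 * √G.card / n * ((G.card : ℝ)⁻¹ * ∑ j ∈ G, (rank n x k j : ℝ) - (n + 1) / 2) =
      (√G.card)⁻¹ * ∑ j ∈ G, (2 * cdf μ (x j k) - 1) -
        √G.card / n * ∑ i ∈ Finset.range n, (2 * cdf μ (x i k) - 1) +
        2 * (√G.card)⁻¹ * (n : ℝ)⁻¹ *
          ∑ a ∈ offDiagPairs n G, rankKernel μ (x a.1 k) (x a.2 k) := by
  have hn : (n : ℝ) ≠ 0 := by
    rintro h
    obtain rfl : n = 0 := by exact_mod_cast h
    simp only [Finset.range_zero, Finset.subset_empty] at hG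
    simp [hG] at hG0
  have hm : (0 : ℝ) < G.card := by exact_mod_cast Nat.pos_of_ne_zero hG0
  rw [sum_rank_eq hG μ]
  simp only [Finset.sum_sub_distrib, ← Finset.mul_sum, Finset.sum_const, nsmul_eq_mul,
    Finset.card_range]
  obtain ⟨r, hr, hr2⟩ : ∃ r : ℝ, 0 < r ∧ (G.card : ℝ) = r ^ 2 :=
    ⟨√G.card, Real.sqrt_pos.2 hm, (Real.sq_sqrt hm.le).symm⟩
  rw [hr2, Real.sqrt_sq hr.le]
  field_simp
  ring

end SampleIdentities

/-! ### The projection remainder and consistency of the empirical covariance matrix. -/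

section Remainders

variable {Ω : Type*} [MeasurableSpace Ω] {P : Measure Ω} {K : ℕ} {X : ℕ → Ω → Fin K → ℝ}

lemma iIndepFun_eval (hindep : iIndepFun X P) (k : Fin K) : iIndepFun (fun i ω => X i ω k) P :=
  hindep.comp (fun _ x => x k) fun _ => measurable_pi_apply k

lemma map_eval_eq (hident : ∀ i, IdentDistrib (X i) (X 0) P P) (k : Fin K) (i : ℕ) :
    P.map (fun ω => X i ω k) = P.map (fun ω => X 0 ω k) :=
  ((hident i).comp (measurable_pi_apply k)).map_eq

lemma measurable_marginalCDF (Y : Ω → Fin K → ℝ) (k : Fin K) : Measurable (marginalCDF P Y k) :=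
  measurable_cdf

lemma abs_marginalCDF_sub_half_le (Y : Ω → Fin K → ℝ) (k : Fin K) (s : ℝ) :
    |marginalCDF P Y k s - 1 / 2| ≤ 1 := by
  have h1 : 0 ≤ marginalCDF P Y k s := cdf_nonneg _ _
  have h2 : marginalCDF P Y k s ≤ 1 := cdf_le_one _ _
  exact abs_le.2 ⟨by linarith, by linarith⟩

/-- The empirical covariance matrix built from the true marginal distribution functions. -/
noncomputable def oracleSigma (P : Measure Ω) (X : ℕ → Ω → Fin K → ℝ) (n : ℕ) (k k' : Fin K)
    (ω : Ω) : ℝ :=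
  (4 / (n : ℝ)) * ∑ i ∈ Finset.range n, (marginalCDF P (X 0) k (X i ω k) - 1 / 2) *
    (marginalCDF P (X 0) k' (X i ω k') - 1 / 2)

lemma measurable_oracleSigma (hmeas : ∀ i, Measurable (X i)) (n : ℕ) (k k' : Fin K) :
    Measurable (oracleSigma P X n k k') := by
  have hu : ∀ k i, Measurable fun ω => marginalCDF P (X 0) k (X i ω k) := fun k i =>
    (measurable_marginalCDF (X 0) k).comp (by fun_prop)
  unfold oracleSigma
  fun_prop

variable [IsProbabilityMeasure P]

lemma tendstoInMeasure_sum_rankKernel {ξ : ℕ → Ω → ℝ} {μ : Measure ℝ} [IsProbabilityMeasure μ]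
    (hξ : ∀ i, Measurable (ξ i)) (hind : iIndepFun ξ P)
    (hlaw : ∀ i, P.map (ξ i) = μ) (hF : Continuous (cdf μ)) (G : ℕ → Finset ℕ) :
    TendstoInMeasure P (fun (n : ℕ) ω => 2 * (√(G n).card)⁻¹ * (n : ℝ)⁻¹ *
      ∑ a ∈ offDiagPairs n (G n), rankKernel μ (ξ a.1 ω) (ξ a.2 ω)) atTop (fun _ => 0) := by
  have hm : ∀ a : ℕ × ℕ, Measurable fun ω => rankKernel μ (ξ a.1 ω) (ξ a.2 ω) := fun a =>
    measurable_rankKernel.comp ((hξ a.1).prodMk (hξ a.2))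
  have hint : ∀ A : Finset (ℕ × ℕ),
      Integrable (fun ω => (∑ a ∈ A, rankKernel μ (ξ a.1 ω) (ξ a.2 ω)) ^ 2) P := fun A => by
    refine integrable_of_abs_le (C := (∑ a ∈ A, 2) ^ 2) (by fun_prop) fun ω => ?_
    rw [abs_pow]
    gcongr
    exact (Finset.abs_sum_le_sum_abs _ _).trans (Finset.sum_le_sum fun a _ => abs_rankKernel_le _ _)
  refine tendstoInMeasure_zero_of_integral_sq (fun n => ?_) ?_
  · simp_rw [mul_pow _ (∑ a ∈ _, _)]
    exact (hint _).const_mul _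
  -- The bound is `2 ^ 2 * 8 / n`, whatever the size of the group.
  · refine squeeze_zero (fun n => integral_nonneg fun ω => sq_nonneg _) (fun n => ?_)
      (tendsto_const_div_atTop_nhds_zero_nat 32)
    simp_rw [mul_pow _ (∑ a ∈ _, _)]
    rw [integral_const_mul]
    have h1 := integral_sq_sum_rankKernel_le hξ hind hlaw hF (offDiagPairs n (G n))
      fun a ha => (Finset.mem_filter.1 ha).2
    have h2 : ((offDiagPairs n (G n)).card : ℝ) ≤ n * (G n).card := by
      exact_mod_cast card_offDiagPairs_le n (G n)
    calc (2 * (√(G n).card)⁻¹ * (n : ℝ)⁻¹) ^ 2 *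
          ∫ ω, (∑ a ∈ offDiagPairs n (G n), rankKernel μ (ξ a.1 ω) (ξ a.2 ω)) ^ 2 ∂P
        ≤ (2 * (√(G n).card)⁻¹ * (n : ℝ)⁻¹) ^ 2 * (n * (G n).card * 8) := by
          gcongr
          linarith
      _ = 32 * ((n : ℝ)⁻¹ * ((n : ℝ) * (n : ℝ)⁻¹)) * (((G n).card : ℝ) * ((G n).card : ℝ)⁻¹) := by
          rw [mul_pow, mul_pow, inv_pow, Real.sq_sqrt (Nat.cast_nonneg _)]
          ring
      -- Only an inequality: for `n = 0` or an empty group, `a * a⁻¹` is `0`.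
      _ ≤ 32 * ((n : ℝ)⁻¹ * 1) * 1 := by
          gcongr <;> exact mul_inv_le_one
      _ = 32 / n := by ring

lemma integral_marginalCDF (hmeas : Measurable (X 0))
    (hcont : ∀ k, Continuous (marginalCDF P (X 0) k)) (k : Fin K) :
    ∫ ω, marginalCDF P (X 0) k (X 0 ω k) ∂P = 1 / 2 := by
  have hm : Measurable fun ω => X 0 ω k := by fun_prop
  have := Measure.isProbabilityMeasure_map (μ := P) hm.aemeasurable
  have h := integral_cdf_self (hcont k)
  rwa [integral_map hm.aemeasurable measurable_cdf.aestronglyMeasurable] at h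

lemma sigma_eq_integral (hmeas : Measurable (X 0))
    (hcont : ∀ k, Continuous (marginalCDF P (X 0) k)) (k k' : Fin K) :
    sigma P (X 0) k k' = 4 * ∫ ω, (marginalCDF P (X 0) k (X 0 ω k) - 1 / 2) *
      (marginalCDF P (X 0) k' (X 0 ω k') - 1 / 2) ∂P := by
  rw [sigma, Matrix.of_apply, covariance, integral_marginalCDF hmeas hcont,
    integral_marginalCDF hmeas hcont]

lemma integral_sq_empCDF_sub_le (hmeas : ∀ i, Measurable (X i)) (hindep : iIndepFun X P)
    (hident : ∀ i, IdentDistrib (X i) (X 0) P P) {n : ℕ} (hn : n ≠ 0) (k : Fin K) (i : ℕ) :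
    ∫ ω, (empCDF n (fun j => X j ω) k (X i ω k) - marginalCDF P (X 0) k (X i ω k)) ^ 2 ∂P ≤
      (n : ℝ)⁻¹ := by
  have hm : ∀ j, Measurable fun ω => X j ω k := fun j => by fun_prop
  have := Measure.isProbabilityMeasure_map (μ := P) (hm 0).aemeasurable
  simp_rw [marginalCDF, empCDF_sub_cdf hn, mul_pow]
  rw [integral_const_mul]
  have h := integral_sq_sum_cdfKernel_le hm (iIndepFun_eval hindep k) (map_eval_eq hident k)
    (Finset.range n) i
  rw [Finset.card_range] at h
  have hn' : (n : ℝ) ≠ 0 := by exact_mod_cast hn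
  calc ((n : ℝ)⁻¹) ^ 2 * _ ≤ ((n : ℝ)⁻¹) ^ 2 * n := by gcongr
    _ = (n : ℝ)⁻¹ := by field_simp

lemma measurable_empCDF (hmeas : ∀ i, Measurable (X i)) (n : ℕ) (k : Fin K) (i : ℕ) :
    Measurable fun ω => empCDF n (fun j => X j ω) k (X i ω k) := by
  simp_rw [empCDF_eq_sum]
  refine (Finset.measurable_sum _ fun j _ => ?_).const_mul _
  exact measurable_ite_le.comp (f := fun ω => (X j ω k, X i ω k)) (by fun_prop)

lemma measurable_empSigma (hmeas : ∀ i, Measurable (X i)) (n : ℕ) (k k' : Fin K) :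
    Measurable fun ω => empSigma n (fun j => X j ω) k k' := by
  simp only [empSigma, Matrix.of_apply]
  refine (Finset.measurable_sum _ fun j _ => ?_).const_mul _
  exact ((measurable_empCDF hmeas n k j).sub_const _).mul
    ((measurable_empCDF hmeas n k' j).sub_const _)

lemma tendstoInMeasure_oracleSigma (hmeas : ∀ i, Measurable (X i)) (hindep : iIndepFun X P)
    (hident : ∀ i, IdentDistrib (X i) (X 0) P P)
    (hcont : ∀ k, Continuous (marginalCDF P (X 0) k)) (k k' : Fin K) :
    TendstoInMeasure P (fun n => oracleSigma P X n k k') atTop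
      (fun _ => sigma P (X 0) k k') := by
  let f : (Fin K → ℝ) → ℝ := fun x => (marginalCDF P (X 0) k (x k) - 1 / 2) *
    (marginalCDF P (X 0) k' (x k') - 1 / 2)
  have hf : Measurable f :=
    (((measurable_marginalCDF (X 0) k).comp (measurable_pi_apply k)).sub_const _).mul
      (((measurable_marginalCDF (X 0) k').comp (measurable_pi_apply k')).sub_const _)
  have hint : Integrable (f ∘ X 0) P := by
    refine integrable_of_abs_le (C := 1) (hf.comp (hmeas 0)) fun ω => ?_
    simp only [Function.comp_apply, f, abs_mul]
    exact mul_le_one₀ (abs_marginalCDF_sub_half_le _ _ _) (abs_nonneg _)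
      (abs_marginalCDF_sub_half_le _ _ _)
  have h := strong_law_ae_real (fun i => f ∘ X i) hint
    (fun i j hij => (hindep.indepFun hij).comp hf hf) fun i => (hident i).comp hf
  refine tendstoInMeasure_of_tendsto_ae
    (fun n => (measurable_oracleSigma hmeas n k k').aestronglyMeasurable) ?_
  filter_upwards [h] with ω hω
  rw [sigma_eq_integral (hmeas 0) hcont]
  refine (hω.const_mul 4).congr fun n => ?_
  simp only [oracleSigma, Function.comp_apply, f]
  ring

/-- Replacing the empirical by the true distribution function at one observation costs at most `1/n`
in mean square. By Cauchy–Schwarz the whole entry then changes by at most `64 / n` in mean square.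
-/
lemma tendstoInMeasure_empSigma_sub_oracleSigma (hmeas : ∀ i, Measurable (X i))
    (hindep : iIndepFun X P) (hident : ∀ i, IdentDistrib (X i) (X 0) P P) (k k' : Fin K) :
    TendstoInMeasure P (fun n ω => empSigma n (fun j => X j ω) k k' - oracleSigma P X n k k' ω)
      atTop (fun _ => 0) := by
  let p : ℕ → Fin K → ℕ → Ω → ℝ := fun n k i ω =>
    empCDF n (fun j => X j ω) k (X i ω k) - 1 / 2
  let u : Fin K → ℕ → Ω → ℝ := fun k i ω => marginalCDF P (X 0) k (X i ω k) - 1 / 2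
  have hp : ∀ n k i ω, |p n k i ω| ≤ 1 := fun n k i ω => by
    have h := empCDF_mem_Icc n (fun j => X j ω) k (X i ω k)
    simp only [p]
    exact abs_le.2 ⟨by linarith [h.1], by linarith [h.2]⟩
  have hu : ∀ k i ω, |u k i ω| ≤ 1 := fun k i ω => abs_marginalCDF_sub_half_le _ _ _
  have hpm : ∀ n k i, Measurable (p n k i) := fun n k i =>
    (measurable_empCDF hmeas n k i).sub_const _
  have hum : ∀ k i, Measurable (u k i) := fun k i =>
    ((measurable_marginalCDF (X 0) k).comp (by fun_prop)).sub_const _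
  have hint : ∀ n k i, Integrable (fun ω => (p n k i ω - u k i ω) ^ 2) P := fun n k i => by
    have h1 := hpm n k i
    have h2 := hum k i
    refine integrable_of_abs_le (C := (1 + 1) ^ 2) (by fun_prop) fun ω => ?_
    rw [abs_pow]
    gcongr
    exact (abs_sub _ _).trans (add_le_add (hp _ _ _ _) (hu _ _ _))
  have hle : ∀ n k i, n ≠ 0 → ∫ ω, (p n k i ω - u k i ω) ^ 2 ∂P ≤ (n : ℝ)⁻¹ :=
    fun n k i hn => by
      simpa [p, u] using integral_sq_empCDF_sub_le hmeas hindep hident hn k i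
  have hint₂ : ∀ n i, Integrable (fun ω =>
      2 * ((p n k i ω - u k i ω) ^ 2 + (p n k' i ω - u k' i ω) ^ 2)) P := fun n i =>
    ((hint n k i).add (hint n k' i)).const_mul 2
  let B : ℕ → Ω → ℝ := fun n ω => (4 / (n : ℝ)) ^ 2 * (n * ∑ i ∈ Finset.range n,
    2 * ((p n k i ω - u k i ω) ^ 2 + (p n k' i ω - u k' i ω) ^ 2))
  have hB : ∀ n, Integrable (B n) P := fun n =>
    ((integrable_finsetSum _ fun i _ => hint₂ n i).const_mul _).const_mul _
  have hDB : ∀ n ω, (empSigma n (fun j => X j ω) k k' - oracleSigma P X n k k' ω) ^ 2 ≤ B n ω := by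
    intro n ω
    have h := sq_sum_mul_sub_sum_mul_le n (p := fun i => p n k i ω) (q := fun i => p n k' i ω)
      (u := fun i => u k i ω) (v := fun i => u k' i ω) (fun i => hp _ _ _ _) fun i => hu _ _ _
    simp only [empSigma, oracleSigma, Matrix.of_apply, B]
    rw [← mul_sub, mul_pow]
    exact mul_le_mul_of_nonneg_left h (sq_nonneg _)
  have hD : ∀ n, Integrable (fun ω =>
      (empSigma n (fun j => X j ω) k k' - oracleSigma P X n k k' ω) ^ 2) P := fun n => by
    refine (hB n).mono' ?_ (ae_of_all _ fun ω => ?_)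
    · exact (((measurable_empSigma hmeas n k k').sub
        (measurable_oracleSigma hmeas n k k')).pow_const 2).aestronglyMeasurable
    · rw [Real.norm_of_nonneg (sq_nonneg _)]
      exact hDB n ω
  refine tendstoInMeasure_zero_of_integral_sq hD ?_
  refine squeeze_zero' (Eventually.of_forall fun n => integral_nonneg fun ω => sq_nonneg _) ?_
    (tendsto_const_div_atTop_nhds_zero_nat 64)
  filter_upwards [eventually_ne_atTop 0] with n hn
  have hn' : (n : ℝ) ≠ 0 := by exact_mod_cast hn
  calc _ ≤ ∫ ω, B n ω ∂P := integral_mono (hD n) (hB n) (hDB n)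
    _ = (4 / (n : ℝ)) ^ 2 * (n * ∑ i ∈ Finset.range n,
        2 * ((∫ ω, (p n k i ω - u k i ω) ^ 2 ∂P) + ∫ ω, (p n k' i ω - u k' i ω) ^ 2 ∂P)) := by
        simp only [B]
        rw [integral_const_mul, integral_const_mul, integral_finsetSum _ fun i _ => hint₂ n i]
        congr 2
        refine Finset.sum_congr rfl fun i _ => ?_
        rw [integral_const_mul, integral_add (hint n k i) (hint n k' i)]
    _ ≤ (4 / (n : ℝ)) ^ 2 * (n * ∑ i ∈ Finset.range n, 2 * ((n : ℝ)⁻¹ + (n : ℝ)⁻¹)) := by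
        gcongr with i
        · exact hle n k i hn
        · exact hle n k' i hn
    _ = 64 / n := by
        rw [Finset.sum_const, Finset.card_range, nsmul_eq_mul]
        field_simp
        ring

lemma tendstoInMeasure_empSigma (hmeas : ∀ i, Measurable (X i)) (hindep : iIndepFun X P)
    (hident : ∀ i, IdentDistrib (X i) (X 0) P P)
    (hcont : ∀ k, Continuous (marginalCDF P (X 0) k)) (k k' : Fin K) :
    TendstoInMeasure P (fun n ω => empSigma n (fun j => X j ω) k k') atTop
      (fun _ => sigma P (X 0) k k') := by
  have h : TendstoInMeasure P (fun n ω => ![oracleSigma P X n k k' ω,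
      empSigma n (fun j => X j ω) k k' - oracleSigma P X n k k' ω]) atTop
      (fun _ => ![sigma P (X 0) k k', 0]) := by
    refine tendstoInMeasure_pi (c := ![sigma P (X 0) k k', 0]) fun i => ?_
    fin_cases i
    · exact tendstoInMeasure_oracleSigma hmeas hindep hident hcont k k'
    · exact tendstoInMeasure_empSigma_sub_oracleSigma hmeas hindep hident k k'
  simpa using tendstoInMeasure_comp_of_continuousAt
    (f := fun v : Fin 2 → ℝ => v 0 + v 1) (by fun_prop) h

/-- Continuity of inversion at the nonsingular limit suffices, so the value of the inverse at
singular matrices plays no role. -/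
lemma tendstoInMeasure_inv_empSigma (hmeas : ∀ i, Measurable (X i)) (hindep : iIndepFun X P)
    (hident : ∀ i, IdentDistrib (X i) (X 0) P P)
    (hcont : ∀ k, Continuous (marginalCDF P (X 0) k)) (hdet : (sigma P (X 0)).det ≠ 0)
    (q : Fin K × Fin K) :
    TendstoInMeasure P (fun n ω => (empSigma n (fun j => X j ω))⁻¹ q.1 q.2) atTop
      (fun _ => (sigma P (X 0))⁻¹ q.1 q.2) := by
  have h : TendstoInMeasure P (fun n ω (r : Fin K × Fin K) => empSigma n (fun j => X j ω) r.1 r.2)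
      atTop (fun _ r => sigma P (X 0) r.1 r.2) :=
    tendstoInMeasure_pi fun r => tendstoInMeasure_empSigma hmeas hindep hident hcont r.1 r.2
  have hinv : ContinuousAt (Inv.inv : Matrix (Fin K) (Fin K) ℝ → _) (sigma P (X 0)) := by
    refine continuousAt_matrix_inv _ ?_
    rw [Ring.inverse_eq_inv']
    exact continuousAt_inv₀ hdet
  have hc : ContinuousAt
      (fun m : Fin K × Fin K → ℝ => (Matrix.of fun k k' => m (k, k'))⁻¹ q.1 q.2)
      (fun r => sigma P (X 0) r.1 r.2) := by
    have h1 : Continuous fun m : Fin K × Fin K → ℝ =>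
        (Matrix.of fun k k' => m (k, k') : Matrix (Fin K) (Fin K) ℝ) :=
      continuous_matrix fun i j => continuous_apply _
    have h2 : ContinuousAt (fun m : Fin K × Fin K → ℝ =>
        (Matrix.of fun k k' => m (k, k') : Matrix (Fin K) (Fin K) ℝ)⁻¹)
        (fun r => sigma P (X 0) r.1 r.2) := by
      refine ContinuousAt.comp (g := Inv.inv) ?_ h1.continuousAt
      exact hinv
    exact (continuous_apply_apply q.1 q.2).continuousAt.comp h2
  have e : ∀ M : Matrix (Fin K) (Fin K) ℝ, (Matrix.of fun k k' => M k k') = M := fun _ => rfl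
  have key := tendstoInMeasure_comp_of_continuousAt hc h
  simpa only [e] using key

lemma measurable_inv_empSigma (hmeas : ∀ i, Measurable (X i)) (n : ℕ) (k k' : Fin K) :
    Measurable fun ω => (empSigma n (fun j => X j ω))⁻¹ k k' := by
  have hS := measurable_empSigma hmeas n
  -- Cramer's formula makes each entry a measurable expression in the entries, also at singular
  -- matrices, where the real inverse of the determinant is `0`.
  simp only [Matrix.inv_def, Matrix.smul_apply, Ring.inverse_eq_inv, smul_eq_mul,
    Matrix.adjugate_apply, Matrix.det_apply']
  refine Measurable.mul (Measurable.inv (by fun_prop)) ?_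
  refine Finset.measurable_sum _ fun σ _ => (Finset.measurable_prod _ fun i _ => ?_).const_mul _
  simp only [Matrix.updateRow_apply]
  split_ifs
  · exact measurable_const
  · exact hS _ _

end Remainders

/-! ### Group sizes and their limiting proportions. -/

section Groups

lemma sum_fin_succ_sub_castSucc {L : ℕ} (g : Fin (L + 1) → ℝ) :
    ∑ l : Fin L, (g l.succ - g l.castSucc) = g (Fin.last L) - g 0 := by
  rw [Finset.sum_sub_distrib]
  linarith [Fin.sum_univ_succ g, Fin.sum_univ_castSucc g]

/-- The indices of the observations in the `l`-th group. -/
def group {L : ℕ} (N : Fin (L + 1) → ℕ) (l : Fin L) : Finset ℕ := Finset.Ico (N l.castSucc) (N l.succ)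

variable {L : ℕ} {N : Fin (L + 1) → ℕ}

lemma cast_card_group (hN : StrictMono N) (l : Fin L) :
    ((group N l).card : ℝ) = (N l.succ : ℝ) - N l.castSucc := by
  rw [group, Nat.card_Ico, Nat.cast_sub (hN Fin.castSucc_lt_succ).le]

lemma card_group_ne_zero (hN : StrictMono N) (l : Fin L) : (group N l).card ≠ 0 := by
  rw [group, Nat.card_Ico]
  exact Nat.sub_ne_zero_of_lt (hN Fin.castSucc_lt_succ)

lemma group_subset_range (hN : StrictMono N) (l : Fin L) :
    group N l ⊆ Finset.range (N (Fin.last L)) := fun _ hj =>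
  Finset.mem_range.2 ((Finset.mem_Ico.1 hj).2.trans_le (hN.monotone (Fin.le_last _)))

lemma pairwise_disjoint_group (hN : StrictMono N) :
    Pairwise fun l l' => Disjoint (group N l) (group N l') := by
  have h : ∀ l l' : Fin L, l < l' → Disjoint (group N l) (group N l') := fun l l' hl => by
    refine Finset.disjoint_left.2 fun j hj hj' => ?_
    have h1 : N l.succ ≤ N l'.castSucc := hN.monotone (Fin.succ_le_castSucc_iff.2 hl)
    exact absurd ((Finset.mem_Ico.1 hj).2.trans_le h1) (not_lt.2 (Finset.mem_Ico.1 hj').1)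
  intro l l' hne
  rcases lt_or_gt_of_ne hne with hl | hl
  · exact h l l' hl
  · exact (h l' l hl).symm

lemma sum_group_eq_sum_range (hN : StrictMono N) (h0 : N 0 = 0) (f : ℕ → ℝ) :
    ∑ l, ∑ j ∈ group N l, f j = ∑ j ∈ Finset.range (N (Fin.last L)), f j := by
  have h : ∀ l : Fin L, ∑ j ∈ group N l, f j =
      ∑ j ∈ Finset.range (N l.succ), f j - ∑ j ∈ Finset.range (N l.castSucc), f j := fun l =>
    Finset.sum_Ico_eq_sub f (hN Fin.castSucc_lt_succ).le
  simp_rw [h]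
  rw [sum_fin_succ_sub_castSucc fun l => ∑ j ∈ Finset.range (N l), f j, h0]
  simp

variable {M : ℕ → Fin (L + 1) → ℕ} {t : Fin L → ℝ}

/-- Positive limiting proportions force all groups to be nonempty from some `n` on; everything about
the groups is used only for such `n`. -/
lemma eventually_strictMono (ht : ∀ l, 0 < t l)
    (hM : ∀ l : Fin L, Tendsto (fun n : ℕ => ((M n l.succ : ℝ) - (M n l.castSucc : ℝ)) / (n : ℝ))
      atTop (𝓝 (t l))) : ∀ᶠ n in atTop, StrictMono (M n) := by
  filter_upwards [eventually_all.2 fun l => (hM l).eventually (lt_mem_nhds (ht l))] with n hn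
  refine Fin.strictMono_iff_lt_succ.2 fun l => ?_
  have h := hn l
  by_contra hcon
  have h1 : (M n l.succ : ℝ) ≤ M n l.castSucc := by exact_mod_cast not_lt.1 hcon
  exact absurd h (not_lt.2 (div_nonpos_of_nonpos_of_nonneg (by linarith) (Nat.cast_nonneg n)))

lemma tendsto_card_group_div (ht : ∀ l, 0 < t l)
    (hM : ∀ l : Fin L, Tendsto (fun n : ℕ => ((M n l.succ : ℝ) - (M n l.castSucc : ℝ)) / (n : ℝ))
      atTop (𝓝 (t l))) (l : Fin L) :
    Tendsto (fun n : ℕ => ((group (M n) l).card : ℝ) / n) atTop (𝓝 (t l)) := by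
  refine (hM l).congr' ?_
  filter_upwards [eventually_strictMono ht hM] with n hn
  rw [cast_card_group hn]

lemma tendsto_card_group (ht : ∀ l, 0 < t l)
    (hM : ∀ l : Fin L, Tendsto (fun n : ℕ => ((M n l.succ : ℝ) - (M n l.castSucc : ℝ)) / (n : ℝ))
      atTop (𝓝 (t l))) (l : Fin L) :
    Tendsto (fun n : ℕ => (group (M n) l).card) atTop atTop := by
  rw [← tendsto_natCast_atTop_iff (R := ℝ)]
  refine ((tendsto_card_group_div ht hM l).pos_mul_atTop (ht l)
    tendsto_natCast_atTop_atTop).congr' ?_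
  filter_upwards [eventually_ne_atTop 0] with n hn
  have hn' : (n : ℝ) ≠ 0 := by exact_mod_cast hn
  field_simp

lemma sum_limit_proportions_eq_one (h0 : ∀ n, M n 0 = 0) (h1 : ∀ n, M n (Fin.last L) = n)
    (hM : ∀ l : Fin L, Tendsto (fun n : ℕ => ((M n l.succ : ℝ) - (M n l.castSucc : ℝ)) / (n : ℝ))
      atTop (𝓝 (t l))) : ∑ l, t l = 1 := by
  refine tendsto_nhds_unique (tendsto_finsetSum Finset.univ fun l _ => hM l)
    (tendsto_const_nhds.congr' ?_)
  filter_upwards [eventually_ne_atTop 0] with n hn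
  have hn' : (n : ℝ) ≠ 0 := by exact_mod_cast hn
  rw [← Finset.sum_div, sum_fin_succ_sub_castSucc fun l => (M n l : ℝ), h0, h1]
  simp [hn']

end Groups

/-! ### Moments of the scores and factorization of the covariance matrix. -/

section Scores

variable {Ω : Type*} [MeasurableSpace Ω] {P : Measure Ω} {K : ℕ} {X : ℕ → Ω → Fin K → ℝ}

/-- The centred marginal distribution functions, scaled so that the covariance matrix of
`score P Y (Y ω)` is `sigma P Y`. -/
noncomputable def score (P : Measure Ω) (Y : Ω → Fin K → ℝ) (x : Fin K → ℝ) : Fin K → ℝ :=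
  fun k => 2 * marginalCDF P Y k (x k) - 1

lemma measurable_score (Y : Ω → Fin K → ℝ) : Measurable (score P Y) :=
  measurable_pi_iff.2 fun k =>
    (((measurable_marginalCDF Y k).comp (measurable_pi_apply k)).const_mul 2).sub_const 1

lemma abs_score_le (Y : Ω → Fin K → ℝ) (x : Fin K → ℝ) (k : Fin K) : |score P Y x k| ≤ 1 := by
  have h1 : 0 ≤ marginalCDF P Y k (x k) := cdf_nonneg _ _
  have h2 : marginalCDF P Y k (x k) ≤ 1 := cdf_le_one _ _
  exact abs_le.2 ⟨by simp only [score]; linarith, by simp only [score]; linarith⟩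

variable [IsProbabilityMeasure P]

lemma integrable_score (hmeas : Measurable (X 0)) (k : Fin K) :
    Integrable (fun ω => score P (X 0) (X 0 ω) k) P :=
  integrable_of_abs_le ((measurable_pi_apply k).comp ((measurable_score _).comp hmeas))
    fun _ => abs_score_le _ _ _

lemma integral_dotProduct_score (hmeas : Measurable (X 0))
    (hcont : ∀ k, Continuous (marginalCDF P (X 0) k)) (v : Fin K → ℝ) :
    ∫ ω, v ⬝ᵥ score P (X 0) (X 0 ω) ∂P = 0 := by
  simp only [dotProduct]
  rw [integral_finsetSum _ fun k _ => (integrable_score hmeas k).const_mul _]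
  refine Finset.sum_eq_zero fun k _ => ?_
  have hm : Measurable fun ω => marginalCDF P (X 0) k (X 0 ω k) :=
    (measurable_marginalCDF (X 0) k).comp (by fun_prop)
  have hi : Integrable (fun ω => marginalCDF P (X 0) k (X 0 ω k)) P :=
    integrable_of_abs_le hm fun ω => abs_cdf_le_one _
  rw [integral_const_mul]
  simp only [score]
  rw [integral_sub (hi.const_mul 2) (integrable_const _), integral_const_mul,
    integral_marginalCDF hmeas hcont]
  simp

lemma integral_sq_dotProduct_score (hmeas : Measurable (X 0))
    (hcont : ∀ k, Continuous (marginalCDF P (X 0) k)) (v : Fin K → ℝ) :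
    ∫ ω, (v ⬝ᵥ score P (X 0) (X 0 ω)) ^ 2 ∂P = v ⬝ᵥ (sigma P (X 0)).mulVec v := by
  have hint : ∀ k k', Integrable (fun ω => v k * score P (X 0) (X 0 ω) k *
      (v k' * score P (X 0) (X 0 ω) k')) P := fun k k' => by
    have h1 : ∀ k, Measurable fun ω => score P (X 0) (X 0 ω) k := fun k =>
      (measurable_pi_apply k).comp ((measurable_score _).comp hmeas)
    refine integrable_of_abs_le (C := |v k| * 1 * (|v k'| * 1))
      (((h1 k).const_mul _).mul ((h1 k').const_mul _)) fun ω => ?_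
    simp only [abs_mul]
    gcongr <;> exact abs_score_le _ _ _
  simp only [dotProduct, Matrix.mulVec, sq, Finset.sum_mul_sum]
  rw [integral_finsetSum _ fun k _ => integrable_finsetSum _ fun k' _ => hint k k']
  refine Finset.sum_congr rfl fun k _ => ?_
  rw [integral_finsetSum _ fun k' _ => hint k k', Finset.mul_sum]
  refine Finset.sum_congr rfl fun k' _ => ?_
  rw [sigma_eq_integral hmeas hcont, ← integral_const_mul, ← integral_mul_const,
    ← integral_const_mul]
  congr 1
  ext ω
  simp only [score]
  ring

lemma exists_transpose_mul_self {K : ℕ} {S : Matrix (Fin K) (Fin K) ℝ} (hS : S.PosDef) :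
    ∃ B : Matrix (Fin K) (Fin K) ℝ, IsUnit B.det ∧ S = B.transpose * B := by
  open scoped MatrixOrder in
  obtain ⟨B, hB⟩ := CStarAlgebra.nonneg_iff_eq_star_mul_self.mp hS.posSemidef.nonneg
  have hB' : S = B.transpose * B := by
    rw [hB, Matrix.star_eq_conjTranspose, Matrix.conjTranspose_eq_transpose_of_trivial]
  refine ⟨B, ?_, hB'⟩
  have hd := hS.det_pos
  rw [hB', Matrix.det_mul, Matrix.det_transpose] at hd
  exact isUnit_iff_ne_zero.2 fun h => by simp [h] at hd

end Scores

/-! ### The statistic as a continuous function of group sums and parameters. -/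

section Slutsky

variable {K L : ℕ}

/-- The parameters of the Kruskal–Wallis quadratic form: the square roots of the group proportions,
the entries of the inverse covariance matrix, and the remainders. -/
abbrev Param (K L : ℕ) : Type := Fin L ⊕ (Fin K × Fin K) ⊕ (Fin L × Fin K) → ℝ

/-- The matrix stored in the parameters of the quadratic form. -/
def paramMatrix (c : Param K L) : Matrix (Fin K) (Fin K) ℝ :=
  Matrix.of fun k k' => c (.inr (.inl (k, k')))

/-- The vector of the `l`-th group as a function of the whitened group sums `w`. -/
def groupVector (B : Matrix (Fin K) (Fin K) ℝ) (w : EuclideanSpace ℝ (Fin L × Fin K))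
    (c : Param K L) (l : Fin L) : Fin K → ℝ := fun k =>
  ∑ k', B k' k * (w (l, k') - c (.inl l) * ∑ l', c (.inl l') * w (l', k')) + c (.inr (.inr (l, k)))

/-- The Kruskal–Wallis quadratic form as a function of the whitened group sums `w`. -/
def quadForm (B : Matrix (Fin K) (Fin K) ℝ)
    (z : EuclideanSpace ℝ (Fin L × Fin K) × Param K L) : ℝ :=
  ∑ l, groupVector B z.1 z.2 l ⬝ᵥ (paramMatrix z.2).mulVec (groupVector B z.1 z.2 l)

lemma continuous_quadForm (B : Matrix (Fin K) (Fin K) ℝ) :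
    Continuous (quadForm (L := L) B) := by
  change Continuous fun z => quadForm B z
  simp only [quadForm, dotProduct, Matrix.mulVec, paramMatrix, groupVector, Matrix.of_apply]
  fun_prop

/-- The limit of the parameters. -/
noncomputable def limitParam (S : Matrix (Fin K) (Fin K) ℝ) (t : Fin L → ℝ) : Param K L :=
  Sum.elim (fun l => √(t l)) (Sum.elim (fun q => S⁻¹ q.1 q.2) fun _ => 0)

/-- The group vectors are `Bᵀ p` with `p` the residuals, and `S⁻¹ = B⁻¹ (Bᵀ)⁻¹`, so that `B` cancels
and the form is `|p|²`. -/
lemma quadForm_limitParam {S B : Matrix (Fin K) (Fin K) ℝ} (hB : IsUnit B.det)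
    (hS : S = B.transpose * B) (t : Fin L → ℝ) (w : EuclideanSpace ℝ (Fin L × Fin K)) :
    quadForm B (w, limitParam S t) = residualSq (fun l => √(t l)) w := by
  have hM : paramMatrix (limitParam S t) = S⁻¹ := rfl
  have hBt : IsUnit B.transpose.det := by rwa [Matrix.det_transpose]
  simp only [quadForm, hM, residualSq]
  refine Finset.sum_congr rfl fun l _ => ?_
  set p : Fin K → ℝ := fun k => w (l, k) - √(t l) * ∑ l', √(t l') * w (l', k) with hp
  have hV : groupVector B w (limitParam S t) l = B.transpose.mulVec p := by
    ext k
    simp [groupVector, limitParam, Matrix.mulVec, dotProduct, hp]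
  have h1 : S⁻¹.mulVec (B.transpose.mulVec p) = B⁻¹.mulVec p := by
    rw [hS, Matrix.mul_inv_rev, Matrix.mulVec_mulVec, Matrix.mul_assoc,
      Matrix.nonsing_inv_mul _ hBt, Matrix.mul_one]
  rw [hV, h1, Matrix.mulVec_transpose, ← Matrix.dotProduct_mulVec, Matrix.mulVec_mulVec,
    Matrix.mul_nonsing_inv _ hB, Matrix.one_mulVec]
  simp [dotProduct, sq, hp]

/-- The parameters of the quadratic form of the sample `x`. -/
noncomputable def sampleParam (μ : Fin K → Measure ℝ) (n : ℕ) (N : Fin (L + 1) → ℕ)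
    (x : ℕ → Fin K → ℝ) : Param K L :=
  Sum.elim (fun l => √((group N l).card / n)) (Sum.elim (fun q => (empSigma n x)⁻¹ q.1 q.2)
    fun q => 2 * (√(group N q.1).card)⁻¹ * (n : ℝ)⁻¹ *
      ∑ a ∈ offDiagPairs n (group N q.1), rankKernel (μ q.2) (x a.1 q.2) (x a.2 q.2))

lemma scaled_centredMeanRank_eq {n : ℕ} (hn : n ≠ 0) {N : Fin (L + 1) → ℕ} (hN : StrictMono N)
    (h0 : N 0 = 0) (h1 : N (Fin.last L) = n) (μ : Fin K → Measure ℝ)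
    (B : Matrix (Fin K) (Fin K) ℝ) (x z : ℕ → Fin K → ℝ)
    (hz : ∀ i k, ∑ k', B k' k * z i k' = 2 * cdf (μ k) (x i k) - 1) (l : Fin L) (k : Fin K) :
    2 * √(group N l).card / n * centredMeanRank n x (N l.castSucc) (N l.succ) k =
      groupVector B (blockSum (group N) z) (sampleParam μ n N x) l k := by
  have hG : group N l ⊆ Finset.range n := h1 ▸ group_subset_range hN l
  have key := scaled_mean_rank_eq hG (card_group_ne_zero hN l) (μ k) x k
  rw [cast_card_group hN] at key ⊢
  rw [centredMeanRank]
  refine key.trans ?_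
  rw [← cast_card_group hN]
  simp only [groupVector, sampleParam, Sum.elim_inl, Sum.elim_inr]
  congr 1
  have hw : ∀ l, ∑ k', B k' k * blockSum (group N) z (l, k') =
      (√(group N l).card)⁻¹ * ∑ j ∈ group N l, (2 * cdf (μ k) (x j k) - 1) := fun l => by
    simp only [blockSum, ← hz]
    rw [Finset.sum_comm, Finset.mul_sum]
    refine Finset.sum_congr rfl fun k' _ => ?_
    rw [← Finset.mul_sum]
    ring
  have hn0 : (0 : ℝ) < n := by exact_mod_cast Nat.pos_of_ne_zero hn
  -- The groups partition the sample, so the total score is `∑ √m_ℓ' W_ℓ'`. This turns the centring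
  -- by the overall mean into the removal of the component along `√(m_ℓ / n)`.
  have hs : ∑ i ∈ Finset.range n, (2 * cdf (μ k) (x i k) - 1) =
      √n * ∑ l', √((group N l').card / n) * ∑ k', B k' k * blockSum (group N) z (l', k') := by
    rw [← h1, ← sum_group_eq_sum_range hN h0, h1, Finset.mul_sum]
    refine Finset.sum_congr rfl fun l' _ => ?_
    have hm : (0 : ℝ) < (group N l').card := by
      exact_mod_cast Nat.pos_of_ne_zero (card_group_ne_zero hN l')
    have hm' := Real.sqrt_pos.2 hm
    have hn' := Real.sqrt_pos.2 hn0
    rw [hw, Real.sqrt_div hm.le]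
    field_simp
  rw [← hw, hs]
  simp only [mul_sub, Finset.sum_sub_distrib]
  congr 1
  have hswap : ∑ l', √((group N l').card / n) * ∑ k', B k' k * blockSum (group N) z (l', k') =
      ∑ k', B k' k * ∑ l', √((group N l').card / n) * blockSum (group N) z (l', k') := by
    simp only [Finset.mul_sum]
    rw [Finset.sum_comm]
    exact Finset.sum_congr rfl fun _ _ => Finset.sum_congr rfl fun _ _ => by ring
  rw [hswap, Real.sqrt_div (Nat.cast_nonneg _), Finset.mul_sum, Finset.mul_sum]
  refine Finset.sum_congr rfl fun k' _ => ?_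
  have hn' := Real.sqrt_pos.2 hn0
  have hnn : (n : ℝ) = √n * √n := (Real.mul_self_sqrt hn0.le).symm
  generalize (∑ l', √((group N l').card / n) * blockSum (group N) z (l', k')) = c
  generalize √((group N l).card : ℝ) = r
  generalize √(n : ℝ) = s at hn' hnn
  rw [hnn]
  field_simp

lemma statistic_eq_quadForm {n : ℕ} (hn : n ≠ 0) {N : Fin (L + 1) → ℕ} (hN : StrictMono N)
    (h0 : N 0 = 0) (h1 : N (Fin.last L) = n) (μ : Fin K → Measure ℝ)
    (B : Matrix (Fin K) (Fin K) ℝ) (x z : ℕ → Fin K → ℝ)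
    (hz : ∀ i k, ∑ k', B k' k * z i k' = 2 * cdf (μ k) (x i k) - 1) :
    statistic n N x = quadForm B (blockSum (group N) z, sampleParam μ n N x) := by
  have hM : paramMatrix (sampleParam μ n N x) = (empSigma n x)⁻¹ := rfl
  simp only [statistic, quadForm, hM, Finset.mul_sum]
  refine Finset.sum_congr rfl fun l _ => ?_
  have hV : groupVector B (blockSum (group N) z) (sampleParam μ n N x) l =
      (2 * √(group N l).card / n) • centredMeanRank n x (N l.castSucc) (N l.succ) := by
    ext k
    exact (scaled_centredMeanRank_eq hn hN h0 h1 μ B x z hz l k).symm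
  rw [hV, Matrix.mulVec_smul, smul_dotProduct, dotProduct_smul, smul_eq_mul, smul_eq_mul,
    ← cast_card_group hN]
  have hm := Real.sq_sqrt (Nat.cast_nonneg (α := ℝ) (group N l).card)
  -- The weight `4 m / n²` is the square of the scaling `2 √m / n` of the group vector.
  nth_rewrite 1 [← hm]
  ring

variable {Ω : Type*} [MeasurableSpace Ω] {P : Measure Ω} [IsProbabilityMeasure P]
  {X : ℕ → Ω → Fin K → ℝ}

lemma measurable_statistic (hmeas : ∀ i, Measurable (X i)) (n : ℕ) (N : Fin (L + 1) → ℕ) :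
    Measurable fun ω => statistic n N fun i => X i ω := by
  have h1 := measurable_inv_empSigma hmeas n
  have h2 : ∀ a b k, Measurable fun ω => centredMeanRank n (fun i => X i ω) a b k :=
    fun a b k => by
      simp only [centredMeanRank, rank_eq_sum]
      refine (Measurable.const_mul (Finset.measurable_sum _ fun j _ =>
        Finset.measurable_sum _ fun i _ => ?_) _).sub_const _
      exact measurable_ite_le.comp (f := fun ω => (X i ω k, X j ω k)) (by fun_prop)
  simp only [statistic, dotProduct, Matrix.mulVec]
  refine (Finset.measurable_sum _ fun l _ => (Finset.measurable_sum _ fun k _ =>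
    (h2 _ _ k).mul (Finset.measurable_sum _ fun k' _ => (h1 k k').mul (h2 _ _ k'))).const_mul
    _).const_mul _

lemma measurable_sampleParam (hmeas : ∀ i, Measurable (X i)) (μ : Fin K → Measure ℝ) (n : ℕ)
    (N : Fin (L + 1) → ℕ) : Measurable fun ω => sampleParam μ n N fun i => X i ω := by
  refine measurable_pi_iff.2 fun i => ?_
  rcases i with l | q | q
  · exact measurable_const
  · exact measurable_inv_empSigma hmeas n q.1 q.2
  · refine (Finset.measurable_sum _ fun a _ => ?_).const_mul _
    exact measurable_rankKernel.comp (f := fun ω => (X a.1 ω q.2, X a.2 ω q.2)) (by fun_prop)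

lemma tendstoInMeasure_sampleParam (hmeas : ∀ i, Measurable (X i)) (hindep : iIndepFun X P)
    (hident : ∀ i, IdentDistrib (X i) (X 0) P P)
    (hcont : ∀ k, Continuous (marginalCDF P (X 0) k)) (hdet : (sigma P (X 0)).det ≠ 0)
    {N : ℕ → Fin (L + 1) → ℕ} {t : Fin L → ℝ}
    (hN : ∀ l, Tendsto (fun n : ℕ => ((group (N n) l).card : ℝ) / n) atTop (𝓝 (t l))) :
    TendstoInMeasure P
      (fun n ω => sampleParam (fun k => P.map fun ω => X 0 ω k) n (N n) fun i => X i ω) atTop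
      (fun _ => limitParam (sigma P (X 0)) t) := by
  refine tendstoInMeasure_pi fun i => ?_
  rcases i with l | q | q
  · exact tendstoInMeasure_const_of_tendsto (hN l).sqrt
  · exact tendstoInMeasure_inv_empSigma hmeas hindep hident hcont hdet q
  · have hm : ∀ j, Measurable fun ω => X j ω q.2 := fun j => by fun_prop
    have := Measure.isProbabilityMeasure_map (μ := P) (hm 0).aemeasurable
    exact tendstoInMeasure_sum_rankKernel hm (iIndepFun_eval hindep q.2) (map_eval_eq hident q.2)
      (hcont q.2) fun n => group (N n) q.1

lemma tendstoInDistribution_id_of_map_eq {E E' : Type*} [TopologicalSpace E] [MeasurableSpace E]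
    [BorelSpace E] [MeasurableSpace E'] {Y : ℕ → Ω → E} {Z : E' → E} {μ' : Measure E'}
    [IsProbabilityMeasure μ'] {ν : Measure E} [IsProbabilityMeasure ν]
    (h : TendstoInDistribution Y atTop Z (fun _ => P) μ') (hν : μ'.map Z = ν) :
    TendstoInDistribution Y atTop (id : E → E) (fun _ => P) ν := by
  refine ⟨h.forall_aemeasurable, aemeasurable_id, ?_⟩
  have e : (⟨μ'.map Z, Measure.isProbabilityMeasure_map h.aemeasurable_limit⟩ :
      ProbabilityMeasure E) = ⟨ν.map id, Measure.isProbabilityMeasure_map aemeasurable_id⟩ :=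
    Subtype.ext (by simp [hν])
  exact e ▸ h.tendsto

end Slutsky

end KruskalWallis

/-! ### Assembly of the limit theorem. -/

open KruskalWallis in
theorem theorem2 {Ω : Type*} [MeasurableSpace Ω] (P : Measure Ω) [IsProbabilityMeasure P]
    (K L : ℕ)
    (X : ℕ → Ω → Fin K → ℝ)
    (hmeas : ∀ i, Measurable (X i))
    (hindep : iIndepFun X P)
    (hident : ∀ i, IdentDistrib (X i) (X 0) P P)
    (hcont : ∀ k, Continuous (KruskalWallis.marginalCDF P (X 0) k))
    (hpos : (KruskalWallis.sigma P (X 0)).PosDef)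
    (N : ℕ → Fin (L + 1) → ℕ)
    (hN_zero : ∀ n, N n 0 = 0)
    (hN_last : ∀ n, N n (Fin.last L) = n)
    (t : Fin L → ℝ)
    (ht : ∀ l, t l ∈ Set.Ioo (0 : ℝ) 1)
    (hN : ∀ l : Fin L,
      Tendsto (fun n : ℕ => ((N n l.succ : ℝ) - (N n l.castSucc : ℝ)) / (n : ℝ)) atTop (𝓝 (t l))) :
    TendstoInDistribution
      (fun (n : ℕ) (ω : Ω) => KruskalWallis.statistic n (N n) fun i => X i ω)
      atTop (id : ℝ → ℝ) (fun _ => P) (KruskalWallis.chiSquare ((L - 1) * K)) := by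
  have ht0 : ∀ l, 0 < t l := fun l => (ht l).1
  have hdet : (sigma P (X 0)).det ≠ 0 := hpos.det_pos.ne'
  obtain ⟨B, hB, hS⟩ := exists_transpose_mul_self hpos
  have hBt : IsUnit B.transpose.det := by rwa [Matrix.det_transpose]
  -- The whitened score: its covariance matrix is `(Bᵀ)⁻¹ Σ B⁻¹ = 1`.
  let f : (Fin K → ℝ) → Fin K → ℝ := fun x => (B.transpose)⁻¹.mulVec (score P (X 0) x)
  have hf : Measurable f := by
    have h := measurable_score (P := P) (X 0)
    refine measurable_pi_iff.2 fun k => ?_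
    simp only [f, Matrix.mulVec, dotProduct]
    fun_prop
  have hlin : ∀ (u : Fin K → ℝ) ω, ∑ k, u k * f (X 0 ω) k =
      (B⁻¹.mulVec u) ⬝ᵥ score P (X 0) (X 0 ω) := fun u ω => by
    change u ⬝ᵥ f (X 0 ω) = _
    rw [Matrix.dotProduct_mulVec, ← Matrix.mulVec_transpose, Matrix.transpose_nonsing_inv,
      Matrix.transpose_transpose]
  have hvar : ∀ u : Fin K → ℝ, ∫ ω, (∑ k, u k * f (X 0 ω) k) ^ 2 ∂P = ∑ k, u k ^ 2 := fun u => by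
    simp_rw [hlin u]
    rw [integral_sq_dotProduct_score (hmeas 0) hcont, hS, ← Matrix.mulVec_mulVec,
      Matrix.mulVec_mulVec _ B, Matrix.mul_nonsing_inv _ hB, Matrix.one_mulVec,
      Matrix.mulVec_transpose, dotProduct_comm, ← Matrix.dotProduct_mulVec, Matrix.mulVec_mulVec,
      Matrix.mul_nonsing_inv _ hB, Matrix.one_mulVec]
    simp [dotProduct, sq]
  have hclt := tendstoInDistribution_blockSum (Z := fun i ω => f (X i ω))
    (G := fun n => group (N n)) (fun i => hf.comp (hmeas i))
    (hindep.comp (fun _ => f) fun _ => hf) (fun i => (hident i).comp hf)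
    (fun u => by simp_rw [hlin u]; exact integral_dotProduct_score (hmeas 0) hcont _) hvar
    (by filter_upwards [eventually_strictMono ht0 hN] with n hn using pairwise_disjoint_group hn)
    (tendsto_card_group ht0 hN)
  have hslutsky := hclt.continuous_comp_prodMk_of_tendstoInMeasure_const (continuous_quadForm B)
    (tendstoInMeasure_sampleParam hmeas hindep hident hcont hdet (tendsto_card_group_div ht0 hN))
    fun n => (measurable_sampleParam hmeas _ n (N n)).aemeasurable
  refine tendstoInDistribution_id_of_map_eq (tendstoInDistribution_of_tendstoInMeasure_sub _ _
    hslutsky ?_ fun n => (measurable_statistic hmeas n (N n)).aemeasurable) ?_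
  -- The statistic and the quadratic form agree exactly once `n` is nonzero and all groups are
  -- nonempty, so their difference is eventually zero.
  · refine (tendstoInMeasure_const_of_tendsto (u := fun _ => (0 : ℝ)) tendsto_const_nhds).congr' ?_
      (ae_of_all _ fun _ => rfl)
    filter_upwards [eventually_strictMono ht0 hN, eventually_ne_atTop 0] with n hn hn0
    refine ae_of_all _ fun ω => ?_
    have h := statistic_eq_quadForm hn0 hn (hN_zero n) (hN_last n)
      (fun k => P.map fun ω => X 0 ω k) B (fun i => X i ω) (fun i => f (X i ω)) fun i k => by
        change B.transpose.mulVec (f (X i ω)) k = _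
        rw [Matrix.mulVec_mulVec, Matrix.mul_nonsing_inv _ hBt, Matrix.one_mulVec]
        rfl
    exact (sub_eq_zero.2 h).symm
  · have hs : ∑ l, √(t l) ^ 2 = 1 := by
      simp_rw [fun l => Real.sq_sqrt (ht0 l).le]
      exact sum_limit_proportions_eq_one hN_zero hN_last hN
    have hq : (fun w : EuclideanSpace ℝ (Fin L × Fin K) =>
        quadForm B (id w, limitParam (sigma P (X 0)) t)) = residualSq fun l => √(t l) :=
      funext fun w => quadForm_limitParam hB hS t w
    rw [hq, map_residualSq_stdGaussian hs]
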